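/- A discrete memoryless relay channel consists of finite input alphabets $\mathcal X,\mathcal X_1$ (source and relay), finite output alphabets $\mathcal Y,\mathcal Y_1$ (destination and relay) and a transition law $p(y,y_1|x,x_1)$; in a block of $n$ transmissions the channel acts as $\prod_{i=1}^n p(y_i,y_{1,i}|x_i,x_{1,i})$. A $(2^{nR},n)$ code consists of a message set $\mathcal W$ with $\lceil 2^{nR}\rceil$ elements, an encoder $f:\mathcal W\to\mathcal X^n$, relay functions $x_{1,i}=t_i(y_{1,1},\dots,y_{1,i-1})$ for $1\le i\le n$, and a decoder $g:\mathcal Y^n\to\mathcal W$. Its average probability of error is $P_e^{(n)}=\Pr(g(Y^n)\neq w)$, where the message $w$ is uniformly distributed on $\mathcal W$. A rate $R$ is achievable if there is a sequence of $(2^{nR},n)$ codes with $P_e^{(n)}\to0$ as $n\to\infty$. Entropies and mutual informations are in bits, and $[t]^*=\min(t,1)$. **Proposition.** Consider any discrete memoryless relay channel $p(y,y_1|x,x_1)$, any finite set $\hat{\mathcal Y}_1$, and any distributions $p(x)$, $p(x_1)$, $p(\hat y_1|x_1,y_1)$. Let $(X,X_1,Y,Y_1,\hat Y_1)$ have the joint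 distribution $$p(x,x_1,y,y_1,\hat y_1)=p(x)\,p(x_1)\,p(y,y_1|x,x_1)\,p(\hat y_1|x_1,y_1),$$ and put $$R^*=I(X;Y|X_1)+\left[\frac{I(X_1;Y)}{I(Y_1;\hat Y_1|X_1,Y)}\right]^* I(X;\hat Y_1|X_1,Y),$$ where the second summand is read as $0$ if $I(Y_1;\hat Y_1|X_1,Y)=0$ (in that case $I(X;\hat Y_1|X_1,Y)=0$ as well). Then every rate $R<R^*$ is achievable, and every $R\le R^*$ (including the boundary value $R=R^*$) lies in the closure of the set of achievable rates. -/

import Mathlib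

open Filter Topology

noncomputable section

namespace RelayChannel

/-! ## Information measures (in bits) of discrete random variables

`μ` is a probability mass function on a sample space `Ω`, and random variables are functions on `Ω`
with values in finite sets. All logarithms are to base 2. -/

section Information

variable {Ω A B C : Type*} [Fintype A] [Fintype B] [Fintype C]

/-- The probability `Pr(S = a)`. -/
def prob (μ : PMF Ω) (S : Ω → A) (a : A) : ℝ := (μ.map S a).toReal

/-- The entropy `H(S) = -∑ p(a) log p(a)`. -/
def entropy (μ : PMF Ω) (S : Ω → A) : ℝ :=
  -∑ a, prob μ S a * Real.logb 2 (prob μ S a)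

/-- The conditional entropy `H(S | T) = -∑ p(a, b) log p(a | b)`, where terms with `p(a, b) = 0`
vanish. -/
def condEntropy (μ : PMF Ω) (S : Ω → A) (T : Ω → B) : ℝ :=
  -∑ a, ∑ b, prob μ (fun ω => (S ω, T ω)) (a, b) *
    Real.logb 2 (prob μ (fun ω => (S ω, T ω)) (a, b) / prob μ T b)

/-- The mutual information `I(S; T) = H(S) - H(S | T)`. -/
def mutualInfo (μ : PMF Ω) (S : Ω → A) (T : Ω → B) : ℝ :=
  entropy μ S - condEntropy μ S T

/-- The conditional mutual information `I(S; T | U) = H(S | U) - H(S | T, U)`. -/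
def condMutualInfo (μ : PMF Ω) (S : Ω → A) (T : Ω → B) (U : Ω → C) : ℝ :=
  condEntropy μ S U - condEntropy μ S (fun ω => (T ω, U ω))

end Information

/-! ## The discrete memoryless relay channel

`X`, `X₁` are the input alphabets of the source and of the relay, `Y`, `Y₁` the output alphabets at
the destination and at the relay; `W x x₁` is the law `p(y, y₁ | x, x₁)`. -/

/-- A code of block length `n` with `M` messages. At time `i` the relay symbol is a function of the
relay outputs received at the times strictly before `i`. -/
structure Code (X X₁ Y Y₁ : Type*) (M n : ℕ) where
  /-- the encoder -/
  enc : Fin M → Fin n → X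
  /-- the relay functions -/
  relay : (i : Fin n) → (Fin (i : ℕ) → Y₁) → X₁
  /-- the decoder -/
  dec : (Fin n → Y) → Fin M

section Channel

variable {X X₁ Y Y₁ : Type*} {M n : ℕ}

/-- The symbol sent by the relay at time `i` when its channel outputs are `y₁`. -/
def Code.relayInput (c : Code X X₁ Y Y₁ M n) (y₁ : Fin n → Y₁) (i : Fin n) : X₁ :=
  c.relay i fun j => y₁ ⟨j, j.isLt.trans i.isLt⟩

/-- The probability that the memoryless channel delivers `y` to the destination and `y₁` to the
relay, given that message `w` is sent. -/
def Code.outputProb (W : X → X₁ → PMF (Y × Y₁)) (c : Code X X₁ Y Y₁ M n) (w : Fin M)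
    (y : Fin n → Y) (y₁ : Fin n → Y₁) : ℝ :=
  ∏ i, (W (c.enc w i) (c.relayInput y₁ i) (y i, y₁ i)).toReal

variable [Fintype Y] [Fintype Y₁]

/-- The average probability of error `Pr(g(Yⁿ) ≠ w)` for a uniformly distributed message `w`. -/
def Code.errorProb (W : X → X₁ → PMF (Y × Y₁)) (c : Code X X₁ Y Y₁ M n) : ℝ :=
  (1 / (M : ℝ)) * ∑ w : Fin M, ∑ y : Fin n → Y, ∑ y₁ : Fin n → Y₁,
    if c.dec y ≠ w then c.outputProb W w y y₁ else 0

/-- `R` is achievable: there are codes with `⌈2 ^ (n R)⌉` messages and block length `n`,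
`n = 0, 1, 2, …`, whose average probability of error tends to `0`. -/
def Achievable (W : X → X₁ → PMF (Y × Y₁)) (R : ℝ) : Prop :=
  ∃ c : (n : ℕ) → Code X X₁ Y Y₁ ⌈(2 : ℝ) ^ ((n : ℝ) * R)⌉₊ n,
    Tendsto (fun n => (c n).errorProb W) atTop (𝓝 0)

end Channel

/-! ## The estimate-and-forward rate with time-sharing -/

section Rate

variable {X X₁ Y Y₁ Yh : Type*}

/-- A realization of `(X, X₁, Y, Y₁, Ŷ₁)`. -/
structure Outcome (X X₁ Y Y₁ Yh : Type*) where
  /-- the source symbol -/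
  x : X
  /-- the relay symbol -/
  x₁ : X₁
  /-- the output at the destination -/
  y : Y
  /-- the output at the relay -/
  y₁ : Y₁
  /-- the compressed relay output -/
  yh : Yh

/-- The joint distribution `p(x) p(x₁) p(y, y₁ | x, x₁) p(ŷ₁ | x₁, y₁)`. -/
def jointLaw (W : X → X₁ → PMF (Y × Y₁)) (p : PMF X) (p₁ : PMF X₁) (V : X₁ → Y₁ → PMF Yh) :
    PMF (Outcome X X₁ Y Y₁ Yh) :=
  p.bind fun x => p₁.bind fun x₁ => (W x x₁).bind fun o =>
    (V x₁ o.2).map fun yh => ⟨x, x₁, o.1, o.2, yh⟩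

/-- `[t]^* = min (t, 1)`. -/
def clip (t : ℝ) : ℝ := min t 1

variable [Fintype X] [Fintype X₁] [Fintype Y] [Fintype Y₁] [Fintype Yh]

/-- `I(X; Y | X₁) + [I(X₁; Y) / I(Y₁; Ŷ₁ | X₁, Y)]^* I(X; Ŷ₁ | X₁, Y)`. If the denominator is zero,
then so is `I(X; Ŷ₁ | X₁, Y)`, and the second summand is zero. -/
def tafRate (μ : PMF (Outcome X X₁ Y Y₁ Yh)) : ℝ :=
  condMutualInfo μ Outcome.x Outcome.y Outcome.x₁ +
    clip (mutualInfo μ Outcome.x₁ Outcome.y /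
        condMutualInfo μ Outcome.y₁ Outcome.yh (fun ω => (ω.x₁, ω.y))) *
      condMutualInfo μ Outcome.x Outcome.yh (fun ω => (ω.x₁, ω.y))

end Rate

end RelayChannel

end

/-!
The rate is reached by block Markov coding with compression at the relay, random binning and joint
decoding, over a model in which the compressed relay output is erased with a fixed probability.

*One block.* The relay is in a state `s`, known from the previous block, and sends the input
`x₁(s)`. For each state there are `L` compression codewords, drawn from `p(ŷ₁ | x₁(s))` and thrown
into bins uniformly at random; the relay selects a codeword for its output, and the bin of the
codeword is its next state. The destination recovers the present state from its output, treating
the source as noise. When it also knows the next state, it looks for a message that passes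
likelihood tests together with the relay input, the output and some codeword of that bin. The
relay selects a codeword for which the tests are least likely to fail, and `sum_pi_min_le` bounds
that probability. This covering argument needs no typical sequences, and the relation between the
selected codeword and the pair of source word and output, which follows from the Markov chain
`Ŷ₁ → (X₁, Y₁) → (X, Y)`, is built into the criterion. For a wrong message (`sum_wrong_message_le`)
the selected codeword is harmless since the wrong source word is independent of it. The other
codewords of the bin share it only by the random binning, so that each of them can be treated as
independent of the output although the selection depends on all of them. `Model.exists_blockCode`
collects the bounds, chooses a codebook, and discards the states that are bad for it.

*Long blocks.* The tests compare products of single-letter likelihoods, so the Chernoff bound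
`tendsto_prob_prod_le` controls them. `Model.eventually_exists_blockCode` obtains good block
codes whenever `R < I(X; Y, Ŷ₁ | X₁)` and
`R + I(Y₁; Ŷ₁ | X₁) < I(X; Y | X₁) + I(Ŷ₁; X, Y | X₁) + I(X₁; Y)`.

*Many blocks.* A block code that is good in every state can be iterated, since the failure in a
block depends on the past only through the state; `sum_path_fail_le` is the union bound. The
destination uses the estimates of consecutive states, so the last block carries no message, a
loss which is negligible for many blocks (`achievable_of_lt`).

*Erasures.* Keeping `Ŷ₁` with probability `α` multiplies `I(Y₁; Ŷ₁ | X₁, Y)` and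
`I(X; Ŷ₁ | X₁, Y)` by `α`. With `α = [I(X₁; Y) / I(Y₁; Ŷ₁ | X₁, Y)]^*` both conditions above hold
below the claimed rate, by the identity `Model.residualRate_eq`.
-/

noncomputable section

namespace RelayChannel

/-! ### Finite expectations -/

section Tools

open scoped Classical in
/-- The real-valued indicator of a proposition. -/
def ind (P : Prop) : ℝ := if P then 1 else 0

lemma ind_true {P : Prop} (h : P) : ind P = 1 := if_pos h

lemma ind_false {P : Prop} (h : ¬P) : ind P = 0 := if_neg h

lemma ind_nonneg (P : Prop) : 0 ≤ ind P := by
  unfold ind; split_ifs <;> norm_num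

lemma ind_le_one (P : Prop) : ind P ≤ 1 := by
  unfold ind; split_ifs <;> norm_num

lemma ind_mono {P Q : Prop} (h : P → Q) : ind P ≤ ind Q := by
  by_cases hP : P
  · rw [ind_true hP, ind_true (h hP)]
  · rw [ind_false hP]; exact ind_nonneg _

lemma ind_or_le (P Q : Prop) : ind (P ∨ Q) ≤ ind P + ind Q := by
  by_cases hP : P
  · rw [ind_true (Or.inl hP), ind_true hP]; linarith [ind_nonneg Q]
  · rw [ind_false hP, zero_add]; exact ind_mono fun h => h.resolve_left hP

lemma ind_exists_le {ι : Type*} (s : Finset ι) (P : ι → Prop) :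
    ind (∃ i ∈ s, P i) ≤ ∑ i ∈ s, ind (P i) := by
  by_cases h : ∃ i ∈ s, P i
  · obtain ⟨i, hi, hP⟩ := h
    rw [ind_true ⟨i, hi, hP⟩, ← ind_true hP]
    exact Finset.single_le_sum (f := fun i => ind (P i)) (fun _ _ => ind_nonneg _) hi
  · rw [ind_false h]; exact Finset.sum_nonneg fun _ _ => ind_nonneg _

lemma ind_add_ind_not (P : Prop) : ind P + ind (¬P) = 1 := by
  by_cases h : P
  · rw [ind_true h, ind_false (not_not.mpr h), add_zero]
  · rw [ind_false h, ind_true h, zero_add]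

variable {ι A : Type*} [Fintype ι] [Fintype A]

lemma sum_pi_prod [DecidableEq ι] {A : ι → Type*} [∀ i, Fintype (A i)] (f : ∀ i, A i → ℝ) :
    ∑ c : ∀ i, A i, ∏ i, f i (c i) = ∏ i, ∑ a, f i a := by
  rw [Finset.prod_univ_sum, Fintype.piFinset_univ]

lemma sum_pi_weight [DecidableEq ι] {f : A → ℝ} (hf : ∑ a, f a = 1) :
    ∑ c : ι → A, ∏ i, f (c i) = 1 := by
  rw [sum_pi_prod (fun _ : ι => f)]; simp [hf]

/-- Under a product weight, one coordinate can be redrawn independently of all the others. -/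
lemma sum_pi_resample [DecidableEq ι] {f : A → ℝ} (hf : ∑ a, f a = 1) (i : ι)
    (G : (ι → A) → ℝ) :
    ∑ c : ι → A, (∏ j, f (c j)) * G c =
      ∑ a, f a * ∑ c : ι → A, (∏ j, f (c j)) * G (Function.update c i a) := by
  classical
  have key : ∀ G : (ι → A) → ℝ, ∑ c : ι → A, (∏ j, f (c j)) * G c =
      ∑ a, f a * ∑ c' : {j // j ≠ i} → A, (∏ j, f (c' j)) *
        G ((Equiv.funSplitAt i A).symm (a, c')) := by
    intro G
    rw [← Equiv.sum_comp (Equiv.funSplitAt i A).symm, Fintype.sum_prod_type]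
    refine Finset.sum_congr rfl fun a _ => ?_
    rw [Finset.mul_sum]
    refine Finset.sum_congr rfl fun c' _ => ?_
    rw [Fintype.prod_eq_mul_prod_subtype_ne _ i, ← mul_assoc]
    congr 2
    · simp
    · exact Finset.prod_congr rfl fun j _ => by simp [j.2]
  have h2 : ∀ a, ∑ c : ι → A, (∏ j, f (c j)) * G (Function.update c i a) =
      ∑ c' : {j // j ≠ i} → A, (∏ j, f (c' j)) * G ((Equiv.funSplitAt i A).symm (a, c')) := by
    intro a
    rw [key fun c => G (Function.update c i a), ← one_mul (∑ c' : {j // j ≠ i} → A, _), ← hf,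
      Finset.sum_mul]
    refine Finset.sum_congr rfl fun b _ => ?_
    congr 1
    refine Finset.sum_congr rfl fun c' _ => ?_
    congr 2
    funext j
    by_cases h : j = i
    · subst h; simp
    · simp [h]
  rw [key G]
  exact Finset.sum_congr rfl fun a _ => by rw [h2]

lemma sum_pi_marginal [DecidableEq ι] {f : A → ℝ} (hf : ∑ a, f a = 1) (i : ι) (g : A → ℝ) :
    ∑ c : ι → A, (∏ j, f (c j)) * g (c i) = ∑ a, f a * g a := by
  rw [sum_pi_resample hf i]
  refine Finset.sum_congr rfl fun a _ => ?_
  simp [← Finset.sum_mul, sum_pi_weight hf]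

lemma sum_pi_marginal₂ [DecidableEq ι] {f : A → ℝ} (hf : ∑ a, f a = 1) {i j : ι} (h : j ≠ i)
    (g : A → A → ℝ) :
    ∑ c : ι → A, (∏ j, f (c j)) * g (c i) (c j) = ∑ a, f a * ∑ b, f b * g a b := by
  rw [sum_pi_resample hf i]
  refine Finset.sum_congr rfl fun a _ => ?_
  rw [← sum_pi_marginal hf j]
  simp [h]

lemma exists_le_of_weighted_sum_le {f e : A → ℝ} {r : ℝ} (h0 : ∀ a, 0 ≤ f a)
    (hf : ∑ a, f a = 1) (h : ∑ a, f a * e a ≤ r) : ∃ a, e a ≤ r := by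
  by_contra! hc
  have hne : ∃ a, 0 < f a := by
    by_contra! h'
    have : ∑ a, f a ≤ 0 := Finset.sum_nonpos fun a _ => h' a
    linarith
  obtain ⟨a, ha⟩ := hne
  have : ∑ b, f b * r < ∑ b, f b * e b :=
    Finset.sum_lt_sum (fun b _ => mul_le_mul_of_nonneg_left (hc b).le (h0 b))
      ⟨a, Finset.mem_univ _, mul_lt_mul_of_pos_left (hc a) ha⟩
  rw [← Finset.sum_mul, hf, one_mul] at this
  linarith

/-- Expurgation: if the average of `e ≥ 0` is at most `ε`, then more than half of the points have
`e ≤ 2 ε`. -/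
lemma exists_embedding_le_two_mul {e : A → ℝ} {ε : ℝ} {N : ℕ} [Nonempty A] (h0 : ∀ a, 0 ≤ e a)
    (hε : 0 < ε) (h : ∑ a, e a ≤ Fintype.card A * ε) (hN : N ≤ Fintype.card A / 2 + 1) :
    ∃ f : Fin N ↪ A, ∀ i, e (f i) ≤ 2 * ε := by
  classical
  set G := Finset.univ.filter fun a => e a ≤ 2 * ε
  set Bd := Finset.univ.filter fun a => ¬ e a ≤ 2 * ε
  have hGB : G.card + Bd.card = Fintype.card A := by
    rw [← Finset.card_univ]
    exact Finset.card_filter_add_card_filter_not _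
  have hc : 0 < Fintype.card A := Fintype.card_pos
  have hB : 2 * Bd.card < Fintype.card A := by
    by_cases hB0 : Bd.card = 0
    · omega
    have hne : Bd.Nonempty := Finset.card_pos.mp (Nat.pos_of_ne_zero hB0)
    have h1 : ∑ _a ∈ Bd, 2 * ε < ∑ a ∈ Bd, e a :=
      Finset.sum_lt_sum_of_nonempty hne fun a ha => by
        simpa using (Finset.mem_filter.mp ha).2
    have h2 : ∑ a ∈ Bd, e a ≤ ∑ a, e a :=
      Finset.sum_le_sum_of_subset_of_nonneg (Finset.subset_univ _) fun a _ _ => h0 a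
    rw [Finset.sum_const, nsmul_eq_mul] at h1
    have : (2 * Bd.card : ℝ) * ε < Fintype.card A * ε := by linarith
    have := lt_of_mul_lt_mul_right this hε.le
    exact_mod_cast this
  have hG : N ≤ Fintype.card G := by rw [Fintype.card_coe]; omega
  obtain ⟨f⟩ := Function.Embedding.nonempty_of_card_le (α := Fin N) (β := G) (by simpa using hG)
  exact ⟨f.trans (Function.Embedding.subtype _), fun i => by
    simpa using (Finset.mem_filter.mp (f i).2).2⟩

lemma sum_pos_of_term {ι : Type*} [Fintype ι] {f : ι → ℝ} (h0 : ∀ i, 0 ≤ f i) {i : ι}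
    (h : 0 < f i) : 0 < ∑ i, f i :=
  Finset.sum_pos' (fun i _ => h0 i) ⟨i, Finset.mem_univ _, h⟩

lemma mul_div_le_of_nonneg {a b : ℝ} (ha : 0 ≤ a) (hb : 0 ≤ b) : a * (b / a) ≤ b := by
  rcases ha.eq_or_lt with h | h
  · rw [← h, zero_mul]; exact hb
  · rw [mul_div_cancel₀ _ h.ne']

lemma epsilon_ne_imp {ι : Type*} [Nonempty ι] {P : ι → Prop} {i : ι}
    (h : Classical.epsilon P ≠ i) : ¬P i ∨ ∃ j, j ≠ i ∧ P j := by
  by_cases hi : P i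
  · exact Or.inr ⟨_, h, Classical.epsilon_spec ⟨i, hi⟩⟩
  · exact Or.inl hi

lemma sum_uniform {S : ℕ} (hS : 0 < S) : ∑ _s : Fin S, (S : ℝ)⁻¹ = 1 := by
  simp [hS.ne']

lemma tendsto_two_rpow_mul {c : ℝ} (hc : c < 0) :
    Tendsto (fun k : ℕ => (2 : ℝ) ^ ((k : ℝ) * c)) atTop (𝓝 0) := by
  have h : Tendsto (fun k : ℕ => ((2 : ℝ) ^ c) ^ k) atTop (𝓝 0) :=
    tendsto_pow_atTop_nhds_zero_of_lt_one (by positivity)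
      (Real.rpow_lt_one_of_one_lt_of_neg (by norm_num) hc)
  refine h.congr fun k => ?_
  rw [mul_comm, Real.rpow_mul (by norm_num), Real.rpow_natCast]

lemma tendsto_two_rpow_mul_atTop {c : ℝ} (hc : 0 < c) :
    Tendsto (fun k : ℕ => (2 : ℝ) ^ ((k : ℝ) * c)) atTop atTop := by
  have h : Tendsto (fun k : ℕ => ((2 : ℝ) ^ c) ^ k) atTop atTop :=
    tendsto_pow_atTop_atTop_of_one_lt (Real.one_lt_rpow (by norm_num) hc)
  refine h.congr fun k => ?_
  rw [mul_comm, Real.rpow_mul (by norm_num), Real.rpow_natCast]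

lemma mul_logb_mul_div_mul (r a b : ℝ) :
    r * Real.logb 2 (r * a / (r * b)) = r * Real.logb 2 (a / b) := by
  by_cases h : r = 0
  · rw [h, zero_mul, zero_mul]
  · rw [mul_div_mul_left _ _ h]

lemma logb_div_eq {a b : ℝ} (ha : 0 < a) (hb : 0 < b) :
    Real.logb 2 (a / b) = Real.logb 2 a - Real.logb 2 b := Real.logb_div ha.ne' hb.ne'

end Tools

/-! ### The one-shot random coding bound for one block -/

section OneShot

/-- The single-block setting in real-valued form: input laws `p` and `p₁`, the channel `W` and the
compression kernel `V`. -/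
structure Model (A A₁ B B₁ C : Type*) [Fintype A] [Fintype A₁] [Fintype B] [Fintype B₁]
    [Fintype C] where
  /-- the law of the source symbol -/
  p : A → ℝ
  /-- the law of the relay symbol -/
  p₁ : A₁ → ℝ
  /-- the channel law -/
  W : A → A₁ → B → B₁ → ℝ
  /-- the compression kernel -/
  V : A₁ → B₁ → C → ℝ
  p_nonneg : ∀ x, 0 ≤ p x
  p₁_nonneg : ∀ x₁, 0 ≤ p₁ x₁
  W_nonneg : ∀ x x₁ y y₁, 0 ≤ W x x₁ y y₁
  V_nonneg : ∀ x₁ y₁ c, 0 ≤ V x₁ y₁ c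
  sum_p : ∑ x, p x = 1
  sum_p₁ : ∑ x₁, p₁ x₁ = 1
  sum_W : ∀ x x₁, ∑ y, ∑ y₁, W x x₁ y y₁ = 1
  sum_V : ∀ x₁ y₁, ∑ c, V x₁ y₁ c = 1

variable {A A₁ B B₁ C : Type*} [Fintype A] [Fintype A₁] [Fintype B] [Fintype B₁] [Fintype C]

namespace Model

variable (m : Model A A₁ B B₁ C)

/-- The law `p(y | x, x₁)`. -/
def outGivenInputs (x : A) (x₁ : A₁) (y : B) : ℝ := ∑ y₁, m.W x x₁ y y₁

/-- The law `p(y | x₁)`. -/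
def outLaw (x₁ : A₁) (y : B) : ℝ := ∑ x, m.p x * m.outGivenInputs x x₁ y

/-- The law `p(y)`. -/
def outMarginal (y : B) : ℝ := ∑ x₁, m.p₁ x₁ * m.outLaw x₁ y

/-- The law `p(y₁ | x₁)`. -/
def relayOutLaw (x₁ : A₁) (y₁ : B₁) : ℝ := ∑ x, m.p x * ∑ y, m.W x x₁ y y₁

/-- The law `p(ŷ₁ | x₁)`, from which the compression codewords are drawn. -/
def compLaw (x₁ : A₁) (c : C) : ℝ := ∑ y₁, m.relayOutLaw x₁ y₁ * m.V x₁ y₁ c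

/-- The law `p(y, ŷ₁ | x, x₁)`. -/
def pairGivenInputs (x : A) (x₁ : A₁) (y : B) (c : C) : ℝ := ∑ y₁, m.W x x₁ y y₁ * m.V x₁ y₁ c

/-- The law `p(y, ŷ₁ | x₁)`. -/
def pairLaw (x₁ : A₁) (y : B) (c : C) : ℝ := ∑ x, m.p x * m.pairGivenInputs x x₁ y c

/-- The joint law `p(x) p(x₁) p(y, y₁ | x, x₁) p(ŷ₁ | x₁, y₁)`. -/
def joint (z : A × A₁ × B × B₁ × C) : ℝ :=
  m.p z.1 * m.p₁ z.2.1 * m.W z.1 z.2.1 z.2.2.1 z.2.2.2.1 * m.V z.2.1 z.2.2.2.1 z.2.2.2.2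

/-- Expectation under the joint law. -/
def expect (f : A → A₁ → B → B₁ → C → ℝ) : ℝ :=
  ∑ z : A × A₁ × B × B₁ × C, m.joint z * f z.1 z.2.1 z.2.2.1 z.2.2.2.1 z.2.2.2.2

lemma outGivenInputs_nonneg (x x₁ y) : 0 ≤ m.outGivenInputs x x₁ y :=
  Finset.sum_nonneg fun _ _ => m.W_nonneg _ _ _ _

lemma outLaw_nonneg (x₁ y) : 0 ≤ m.outLaw x₁ y :=
  Finset.sum_nonneg fun _ _ => mul_nonneg (m.p_nonneg _) (m.outGivenInputs_nonneg _ _ _)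

lemma outMarginal_nonneg (y) : 0 ≤ m.outMarginal y :=
  Finset.sum_nonneg fun _ _ => mul_nonneg (m.p₁_nonneg _) (m.outLaw_nonneg _ _)

lemma relayOutLaw_nonneg (x₁ y₁) : 0 ≤ m.relayOutLaw x₁ y₁ :=
  Finset.sum_nonneg fun _ _ => mul_nonneg (m.p_nonneg _)
    (Finset.sum_nonneg fun _ _ => m.W_nonneg _ _ _ _)

lemma compLaw_nonneg (x₁ c) : 0 ≤ m.compLaw x₁ c :=
  Finset.sum_nonneg fun _ _ => mul_nonneg (m.relayOutLaw_nonneg _ _) (m.V_nonneg _ _ _)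

lemma pairGivenInputs_nonneg (x x₁ y c) : 0 ≤ m.pairGivenInputs x x₁ y c :=
  Finset.sum_nonneg fun _ _ => mul_nonneg (m.W_nonneg _ _ _ _) (m.V_nonneg _ _ _)

lemma pairLaw_nonneg (x₁ y c) : 0 ≤ m.pairLaw x₁ y c :=
  Finset.sum_nonneg fun _ _ => mul_nonneg (m.p_nonneg _) (m.pairGivenInputs_nonneg _ _ _ _)

lemma joint_nonneg (z) : 0 ≤ m.joint z :=
  mul_nonneg (mul_nonneg (mul_nonneg (m.p_nonneg _) (m.p₁_nonneg _)) (m.W_nonneg _ _ _ _))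
    (m.V_nonneg _ _ _)

lemma sum_relayOutLaw (x₁) : ∑ y₁, m.relayOutLaw x₁ y₁ = 1 := by
  unfold relayOutLaw
  rw [Finset.sum_comm, ← m.sum_p]
  refine Finset.sum_congr rfl fun x _ => ?_
  rw [← Finset.mul_sum, Finset.sum_comm, m.sum_W, mul_one]

lemma sum_compLaw (x₁) : ∑ c, m.compLaw x₁ c = 1 := by
  unfold compLaw
  rw [Finset.sum_comm, ← m.sum_relayOutLaw x₁]
  refine Finset.sum_congr rfl fun x _ => ?_
  rw [← Finset.mul_sum, m.sum_V, mul_one]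

lemma sum_outLaw (x₁) : ∑ y, m.outLaw x₁ y = 1 := by
  unfold outLaw outGivenInputs
  rw [Finset.sum_comm, ← m.sum_p]
  refine Finset.sum_congr rfl fun x _ => ?_
  rw [← Finset.mul_sum, m.sum_W, mul_one]

lemma expect_eq (f : A → A₁ → B → B₁ → C → ℝ) : m.expect f =
    ∑ x₁, m.p₁ x₁ * ∑ x, m.p x * ∑ y, ∑ y₁, m.W x x₁ y y₁ *
      ∑ c, m.V x₁ y₁ c * f x x₁ y y₁ c := by
  unfold expect joint
  simp only [Fintype.sum_prod_type]
  rw [Finset.sum_comm]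
  simp only [Finset.mul_sum]
  refine Finset.sum_congr rfl fun _ _ => Finset.sum_congr rfl fun _ _ =>
    Finset.sum_congr rfl fun _ _ => Finset.sum_congr rfl fun _ _ =>
    Finset.sum_congr rfl fun _ _ => by ring

lemma expect_congr {f g : A → A₁ → B → B₁ → C → ℝ}
    (h : ∀ x x₁ y y₁ c, 0 < m.joint (x, x₁, y, y₁, c) → f x x₁ y y₁ c = g x x₁ y y₁ c) :
    m.expect f = m.expect g := by
  refine Finset.sum_congr rfl fun z _ => ?_
  rcases (m.joint_nonneg z).eq_or_lt with hz | hz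
  · rw [← hz, zero_mul, zero_mul]
  · rw [h _ _ _ _ _ hz]

lemma expect_sub (f g : A → A₁ → B → B₁ → C → ℝ) :
    m.expect (fun x x₁ y y₁ c => f x x₁ y y₁ c - g x x₁ y y₁ c) = m.expect f - m.expect g := by
  simp only [expect, mul_sub, Finset.sum_sub_distrib]

lemma expect_add (f g : A → A₁ → B → B₁ → C → ℝ) :
    m.expect (fun x x₁ y y₁ c => f x x₁ y y₁ c + g x x₁ y y₁ c) = m.expect f + m.expect g := by
  simp only [expect, mul_add, Finset.sum_add_distrib]

lemma expect_const_mul (r : ℝ) (f : A → A₁ → B → B₁ → C → ℝ) :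
    m.expect (fun x x₁ y y₁ c => r * f x x₁ y y₁ c) = r * m.expect f := by
  simp only [expect, Finset.mul_sum, mul_left_comm]

lemma expect_input_output (f : A → A₁ → B → ℝ) : m.expect (fun x x₁ y _ _ => f x x₁ y) =
    ∑ x₁, m.p₁ x₁ * ∑ x, m.p x * ∑ y, ∑ y₁, m.W x x₁ y y₁ * f x x₁ y := by
  rw [expect_eq]
  simp only [← Finset.sum_mul, m.sum_V, one_mul]

lemma expect_state_output (f : A₁ → B → ℝ) : m.expect (fun _ x₁ y _ _ => f x₁ y) =
    ∑ x₁, m.p₁ x₁ * ∑ y, m.outLaw x₁ y * f x₁ y := by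
  rw [expect_input_output]
  refine Finset.sum_congr rfl fun x₁ _ => ?_
  congr 1
  simp only [outLaw, outGivenInputs, Finset.mul_sum, Finset.sum_mul]
  rw [Finset.sum_comm]
  refine Finset.sum_congr rfl fun _ _ => Finset.sum_congr rfl fun _ _ =>
    Finset.sum_congr rfl fun _ _ => by ring

lemma expect_relay (f : A₁ → B₁ → C → ℝ) : m.expect (fun _ x₁ _ y₁ c => f x₁ y₁ c) =
    ∑ x₁, m.p₁ x₁ * ∑ y₁, m.relayOutLaw x₁ y₁ * ∑ c, m.V x₁ y₁ c * f x₁ y₁ c := by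
  rw [expect_eq]
  refine Finset.sum_congr rfl fun x₁ _ => ?_
  congr 1
  simp only [relayOutLaw, Finset.sum_mul]
  rw [Finset.sum_comm]
  refine Finset.sum_congr rfl fun x _ => ?_
  rw [Finset.sum_comm, Finset.mul_sum]
  refine Finset.sum_congr rfl fun y₁ _ => ?_
  rw [← Finset.sum_mul, mul_assoc]

lemma expect_pair (f : A → A₁ → B → C → ℝ) : m.expect (fun x x₁ y _ c => f x x₁ y c) =
    ∑ x₁, m.p₁ x₁ * ∑ y₁, ∑ c, m.V x₁ y₁ c *
      ∑ x, m.p x * ∑ y, m.W x x₁ y y₁ * f x x₁ y c := by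
  rw [expect_eq]
  refine Finset.sum_congr rfl fun x₁ _ => ?_
  congr 1
  simp only [Finset.mul_sum]
  have hr : ∀ F : B₁ → C → A → B → ℝ, ∑ y₁, ∑ c, ∑ x, ∑ y, F y₁ c x y =
      ∑ x, ∑ y, ∑ y₁, ∑ c, F y₁ c x y := by
    intro F
    have h1 : ∀ y₁, ∑ c, ∑ x, ∑ y, F y₁ c x y = ∑ x, ∑ y, ∑ c, F y₁ c x y := fun y₁ => by
      rw [Finset.sum_comm]
      exact Finset.sum_congr rfl fun x _ => Finset.sum_comm
    simp only [h1]
    rw [Finset.sum_comm]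
    exact Finset.sum_congr rfl fun x _ => Finset.sum_comm
  rw [hr]
  refine Finset.sum_congr rfl fun _ _ => Finset.sum_congr rfl fun _ _ =>
    Finset.sum_congr rfl fun _ _ => Finset.sum_congr rfl fun _ _ => by ring

end Model

/-- A code for a single block. The relay is in one of `S` states, a state determines the
relay's input block, and its output block determines the state (one of `S'`) for the next block.
The destination estimates the state, and the message from the present and next states. -/
structure BlockCode (A A₁ B B₁ : Type*) (M S S' : ℕ) where
  /-- the encoder of the source -/
  enc : Fin M → A
  /-- the relay input for each state -/
  relay : Fin S → A₁
  /-- the state for the next block -/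
  next : Fin S → B₁ → Fin S'
  /-- the estimate of the present state -/
  decState : B → Fin S
  /-- the estimate of the message from the present state, the next state and the output -/
  decMsg : Fin S → Fin S' → B → Fin M

/-- The destination misses the present state, or misses the message although it knows the present
and the next state. -/
def BlockCode.Fails {M S S' : ℕ} (b : BlockCode A A₁ B B₁ M S S') (s : Fin S) (w : Fin M) (y : B)
    (y₁ : B₁) : Prop :=
  b.decState y ≠ s ∨ b.decMsg s (b.next s y₁) y ≠ w

/-- The probability of failure in a block with present state `s` and message `w`. -/
def BlockCode.err {M S S' : ℕ} (b : BlockCode A A₁ B B₁ M S S') (W : A → A₁ → B → B₁ → ℝ)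
    (s : Fin S) (w : Fin M) : ℝ :=
  ∑ y, ∑ y₁, W (b.enc w) (b.relay s) y y₁ * ind (b.Fails s w y y₁)

/-- Covering by the best of `L` independent codewords: if `v₁, …, v_L` are drawn from `q`, then
the least value of `g ≤ m` among them is essentially no worse than the mean of `g` under `V`, as
soon as `L` is much larger than the likelihood ratio `V / q`. -/
lemma sum_pi_min_le {q V g : C → ℝ} {μ t γ : ℝ} {L : ℕ} (hq : ∀ c, 0 ≤ q c) (hq1 : ∑ c, q c = 1)
    (hV : ∀ c, 0 ≤ V c) (hV1 : ∑ c, V c = 1) (hg : ∀ c, 0 ≤ g c) (hgμ : ∀ c, g c ≤ μ)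
    (hμ : 0 ≤ μ) (ht : 0 < t) (hγ : 0 < γ) (idx : (Fin L → C) → Fin L)
    (hidx : ∀ (v : Fin L → C) (l : Fin L), g (v (idx v)) ≤ g (v l)) :
    ∑ v : Fin L → C, (∏ l, q (v l)) * g (v (idx v)) ≤
      μ * t + (∑ c, V c * g c) / t + μ * ∑ c, V c * ind (γ * q c < V c) +
        μ * Real.exp (-(L / γ)) := by
  set R := ∑ c, q c * ind (t * μ < g c) with hR
  set Q := ∑ c, q c * ind (¬ t * μ < g c) with hQ
  set θ := ∑ c, V c * ind (¬ t * μ < g c ∧ ¬ γ * q c < V c) with hθ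
  have hRQ : R + Q = 1 := by
    rw [hR, hQ, ← Finset.sum_add_distrib, ← hq1]
    refine Finset.sum_congr rfl fun c _ => ?_
    rw [← mul_add, ind_add_ind_not, mul_one]
  have hR0 : 0 ≤ R := Finset.sum_nonneg fun c _ => mul_nonneg (hq c) (ind_nonneg _)
  have hθ0 : 0 ≤ θ := Finset.sum_nonneg fun c _ => mul_nonneg (hV c) (ind_nonneg _)
  have hθ1 : θ ≤ 1 := by
    rw [← hV1]
    exact Finset.sum_le_sum fun c _ => mul_le_of_le_one_right (hV c) (ind_le_one _)
  have hθQ : θ ≤ γ * Q := by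
    rw [hθ, hQ, Finset.mul_sum]
    refine Finset.sum_le_sum fun c _ => ?_
    by_cases h : ¬ t * μ < g c ∧ ¬ γ * q c < V c
    · rw [ind_true h, ind_true h.1]; linarith [h.2]
    · rw [ind_false h, mul_zero]
      exact mul_nonneg hγ.le (mul_nonneg (hq c) (ind_nonneg _))
  have hmin : ∑ v : Fin L → C, (∏ l, q (v l)) * g (v (idx v)) ≤ μ * t + μ * R ^ L := by
    have h1 : ∀ v : Fin L → C, (∏ l, q (v l)) * g (v (idx v)) ≤
        (∏ l, q (v l)) * (μ * t) + μ * ∏ l, (q (v l) * ind (t * μ < g (v l))) := by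
      intro v
      have hp : 0 ≤ ∏ l, q (v l) := Finset.prod_nonneg fun l _ => hq _
      rw [Finset.prod_mul_distrib]
      by_cases h : ∀ l, t * μ < g (v l)
      · rw [Finset.prod_congr rfl fun l _ => ind_true (h l)]
        simp only [Finset.prod_const_one, mul_one]
        nlinarith [mul_le_mul_of_nonneg_left (hgμ (v (idx v))) hp, mul_nonneg hp (mul_nonneg hμ ht.le)]
      · push Not at h
        obtain ⟨l, hl⟩ := h
        rw [Finset.prod_eq_zero (f := fun l => ind (t * μ < g (v l))) (Finset.mem_univ l)
          (ind_false (P := t * μ < g (v l)) (not_lt.mpr hl)), mul_zero, mul_zero, add_zero]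
        exact mul_le_mul_of_nonneg_left (by linarith [hidx v l]) hp
    refine (Finset.sum_le_sum fun v _ => h1 v).trans_eq ?_
    rw [Finset.sum_add_distrib, ← Finset.sum_mul, sum_pi_weight hq1, one_mul, ← Finset.mul_sum,
      sum_pi_prod fun _ c => q c * ind (t * μ < g c)]
    simp [hR]
  have hpow : R ^ L ≤ 1 - θ + Real.exp (-(L / γ)) := by
    have h1 : R ≤ Real.exp (-(θ / γ)) := by
      have : 1 - θ / γ ≤ Real.exp (-(θ / γ)) := by
        have := Real.add_one_le_exp (-(θ / γ)); linarith
      have h2 : θ / γ ≤ Q := by rw [div_le_iff₀ hγ]; linarith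
      linarith
    have h2 : R ^ L ≤ Real.exp (θ * (-(L / γ))) := by
      refine (pow_le_pow_left₀ hR0 h1 L).trans_eq ?_
      rw [← Real.exp_nat_mul]; congr 1; ring
    have h3 := convexOn_exp.2 (Set.mem_univ (0 : ℝ)) (Set.mem_univ (-((L : ℝ) / γ)))
      (sub_nonneg.mpr hθ1) hθ0 (by ring)
    simp only [smul_eq_mul, mul_zero, zero_add, Real.exp_zero, mul_one] at h3
    have h4 : θ * Real.exp (-(L / γ)) ≤ Real.exp (-(L / γ)) :=
      mul_le_of_le_one_left (Real.exp_pos _).le hθ1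
    linarith
  have hμθ : μ * (1 - θ) ≤ (∑ c, V c * g c) / t + μ * ∑ c, V c * ind (γ * q c < V c) := by
    rw [← hV1, hθ, ← Finset.sum_sub_distrib, Finset.mul_sum, Finset.mul_sum, Finset.sum_div,
      ← Finset.sum_add_distrib]
    refine Finset.sum_le_sum fun c _ => ?_
    have hb : 0 ≤ V c * g c / t := div_nonneg (mul_nonneg (hV c) (hg c)) ht.le
    by_cases h1 : t * μ < g c
    · rw [ind_false (fun h => h.1 h1)]
      have h2 : V c * μ ≤ V c * g c / t := by
        rw [le_div_iff₀ ht, mul_assoc]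
        exact mul_le_mul_of_nonneg_left (by linarith) (hV c)
      have := mul_nonneg hμ (mul_nonneg (hV c) (ind_nonneg (γ * q c < V c)))
      linarith
    · by_cases h2 : γ * q c < V c
      · rw [ind_false (fun h => h.2 h2), ind_true h2]; linarith
      · rw [ind_true ⟨h1, h2⟩, ind_false h2]; linarith
  nlinarith [mul_le_mul_of_nonneg_left hpow hμ]

end OneShot

/-! ### Random codebooks with random binning -/

section RandomCode

variable {A A₁ B B₁ C : Type*} [Fintype A] [Fintype A₁] [Fintype B] [Fintype B₁] [Fintype C]

/-- The part of a codebook that belongs to one relay state: the relay input, the compression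
codewords and the assignment of the codewords to bins. The bin is the next state. -/
abbrev StateBook (A₁ C : Type*) (L S : ℕ) := A₁ × (Fin L → C) × (Fin L → Fin S)

variable (m : Model A A₁ B B₁ C) {M S S' L : ℕ}

namespace Model

/-- The law of a random state codebook: relay input from `p₁`, independent compression codewords
from `p(ŷ₁ | x₁)`, independent uniform bins. -/
def bookWeight (δ : StateBook A₁ C L S) : ℝ :=
  m.p₁ δ.1 * ((∏ l, m.compLaw δ.1 (δ.2.1 l)) * ∏ _l : Fin L, (S : ℝ)⁻¹)

lemma bookWeight_nonneg (δ : StateBook A₁ C L S) : 0 ≤ m.bookWeight δ :=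
  mul_nonneg (m.p₁_nonneg _) (mul_nonneg (Finset.prod_nonneg fun _ _ => m.compLaw_nonneg _ _)
    (Finset.prod_nonneg fun _ _ => by positivity))

lemma sum_bookWeight_mul (G : StateBook A₁ C L S → ℝ) : ∑ δ, m.bookWeight δ * G δ =
    ∑ x₁, m.p₁ x₁ * ∑ v : Fin L → C, (∏ l, m.compLaw x₁ (v l)) *
      ∑ β : Fin L → Fin S, (∏ _l : Fin L, (S : ℝ)⁻¹) * G (x₁, v, β) := by
  simp only [bookWeight, Fintype.sum_prod_type, Finset.mul_sum]
  refine Finset.sum_congr rfl fun _ _ => Finset.sum_congr rfl fun _ _ =>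
    Finset.sum_congr rfl fun _ _ => by ring

lemma sum_bookWeight_mul_codewords (hS : 0 < S) (g : A₁ → (Fin L → C) → ℝ) :
    ∑ δ : StateBook A₁ C L S, m.bookWeight δ * g δ.1 δ.2.1 =
      ∑ x₁, m.p₁ x₁ * ∑ v : Fin L → C, (∏ l, m.compLaw x₁ (v l)) * g x₁ v := by
  rw [sum_bookWeight_mul]
  simp only [← Finset.sum_mul, sum_pi_weight (sum_uniform hS), one_mul]

lemma sum_bookWeight_mul_relay (hS : 0 < S) (g : A₁ → ℝ) :
    ∑ δ : StateBook A₁ C L S, m.bookWeight δ * g δ.1 = ∑ x₁, m.p₁ x₁ * g x₁ := by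
  rw [m.sum_bookWeight_mul_codewords hS fun x₁ _ => g x₁]
  simp only [← Finset.sum_mul, sum_pi_weight (m.sum_compLaw _), one_mul]

lemma sum_bookWeight (hS : 0 < S) : ∑ δ : StateBook A₁ C L S, m.bookWeight δ = 1 := by
  have := m.sum_bookWeight_mul_relay (L := L) hS fun _ => 1
  simpa [m.sum_p₁] using this

variable (T : A → A₁ → B → C → Prop)

/-- The probability that the relay output is `y₁` and the compression codeword `c` fails the test
`T` together with the true source word and destination output, given the relay input `x₁`. -/
def missWeight (x₁ : A₁) (y₁ : B₁) (c : C) : ℝ :=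
  ∑ x, m.p x * ∑ y, m.W x x₁ y y₁ * ind (¬T x x₁ y c)

lemma missWeight_nonneg (x₁ y₁ c) : 0 ≤ m.missWeight T x₁ y₁ c :=
  Finset.sum_nonneg fun _ _ => mul_nonneg (m.p_nonneg _)
    (Finset.sum_nonneg fun _ _ => mul_nonneg (m.W_nonneg _ _ _ _) (ind_nonneg _))

lemma missWeight_le (x₁ y₁ c) : m.missWeight T x₁ y₁ c ≤ m.relayOutLaw x₁ y₁ :=
  Finset.sum_le_sum fun _ _ => mul_le_mul_of_nonneg_left (Finset.sum_le_sum fun _ _ =>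
    mul_le_of_le_one_right (m.W_nonneg _ _ _ _) (ind_le_one _)) (m.p_nonneg _)

/-- The index of the compression codeword that the relay selects: one for which a failure of the
test is least likely. -/
def select [Nonempty (Fin L)] (x₁ : A₁) (y₁ : B₁) (v : Fin L → C) : Fin L :=
  (Finite.exists_min fun l => m.missWeight T x₁ y₁ (v l)).choose

lemma missWeight_select_le [Nonempty (Fin L)] (x₁ : A₁) (y₁ : B₁) (v : Fin L → C) (l : Fin L) :
    m.missWeight T x₁ y₁ (v (m.select T x₁ y₁ v)) ≤ m.missWeight T x₁ y₁ (v l) :=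
  (Finite.exists_min fun l => m.missWeight T x₁ y₁ (v l)).choose_spec l

/-- The selected compression codeword passes the test up to a small probability. -/
lemma sum_select_fail_le [Nonempty (Fin L)] {t γ : ℝ} (ht : 0 < t) (hγ : 0 < γ) :
    ∑ x₁, m.p₁ x₁ * ∑ v : Fin L → C, (∏ l, m.compLaw x₁ (v l)) *
      ∑ x, m.p x * ∑ y, ∑ y₁, m.W x x₁ y y₁ * ind (¬T x x₁ y (v (m.select T x₁ y₁ v))) ≤
    t + m.expect (fun x x₁ y _ c => ind (¬T x x₁ y c)) / t +
      m.expect (fun _ x₁ _ y₁ c => ind (γ * m.compLaw x₁ c < m.V x₁ y₁ c)) +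
      Real.exp (-(L / γ)) := by
  have h1 : ∀ x₁ (v : Fin L → C),
      ∑ x, m.p x * ∑ y, ∑ y₁, m.W x x₁ y y₁ * ind (¬T x x₁ y (v (m.select T x₁ y₁ v))) =
        ∑ y₁, m.missWeight T x₁ y₁ (v (m.select T x₁ y₁ v)) := by
    intro x₁ v
    unfold missWeight
    rw [Finset.sum_comm]
    refine Finset.sum_congr rfl fun x _ => ?_
    rw [← Finset.mul_sum, Finset.sum_comm]
  have h2 : ∀ x₁, ∑ v : Fin L → C, (∏ l, m.compLaw x₁ (v l)) *
      ∑ x, m.p x * ∑ y, ∑ y₁, m.W x x₁ y y₁ * ind (¬T x x₁ y (v (m.select T x₁ y₁ v))) ≤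
      ∑ y₁, (m.relayOutLaw x₁ y₁ * t +
        (∑ c, m.V x₁ y₁ c * m.missWeight T x₁ y₁ c) / t +
        m.relayOutLaw x₁ y₁ * (∑ c, m.V x₁ y₁ c * ind (γ * m.compLaw x₁ c < m.V x₁ y₁ c)) +
        m.relayOutLaw x₁ y₁ * Real.exp (-(L / γ))) := by
    intro x₁
    simp only [h1, Finset.mul_sum (s := (Finset.univ : Finset B₁))]
    rw [Finset.sum_comm]
    refine Finset.sum_le_sum fun y₁ _ => ?_
    exact sum_pi_min_le (m.compLaw_nonneg x₁) (m.sum_compLaw x₁) (m.V_nonneg x₁ y₁)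
      (m.sum_V x₁ y₁) (m.missWeight_nonneg T x₁ y₁) (m.missWeight_le T x₁ y₁)
      (m.relayOutLaw_nonneg x₁ y₁) ht hγ _ fun v l => m.missWeight_select_le T x₁ y₁ v l
  refine (Finset.sum_le_sum fun x₁ _ =>
    mul_le_mul_of_nonneg_left (h2 x₁) (m.p₁_nonneg x₁)).trans_eq ?_
  rw [m.expect_pair, m.expect_relay]
  simp only [Finset.sum_add_distrib, mul_add, ← Finset.sum_mul, m.sum_relayOutLaw, one_mul,
    m.sum_p₁, ← Finset.sum_div, ← mul_div_assoc]
  rfl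

variable {T}

/-- A wrong message passes the test with some codeword of the bin only with small probability.
The selected codeword is treated apart from the others; those lie in the same bin only by chance,
and none of them is correlated with the destination's output. -/
lemma sum_wrong_message_le [Nonempty (Fin L)] (hS : 0 < S) {κA κB : ℝ}
    (hA : ∀ x₁ y c, ∑ x, m.p x * ind (T x x₁ y c) ≤ κA)
    (hB : ∀ x₁, ∑ x, m.p x * ∑ y, m.outLaw x₁ y * ∑ c, m.compLaw x₁ c * ind (T x x₁ y c) ≤ κB) :
    ∑ x, m.p x * ∑ x', m.p x' * ∑ δ : StateBook A₁ C L S, m.bookWeight δ *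
      ∑ y, ∑ y₁, m.W x δ.1 y y₁ * ind (∃ l, δ.2.2 l = δ.2.2 (m.select T δ.1 y₁ δ.2.1) ∧
        T x' δ.1 y (δ.2.1 l)) ≤ κA + L / S * κB := by
  have hF : ∀ x x' (δ : StateBook A₁ C L S), ∑ y, ∑ y₁, m.W x δ.1 y y₁ *
      ind (∃ l, δ.2.2 l = δ.2.2 (m.select T δ.1 y₁ δ.2.1) ∧ T x' δ.1 y (δ.2.1 l)) ≤
      (∑ y, ∑ y₁, m.W x δ.1 y y₁ * ind (T x' δ.1 y (δ.2.1 (m.select T δ.1 y₁ δ.2.1)))) +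
      ∑ y, ∑ y₁, m.W x δ.1 y y₁ * ∑ l ∈ Finset.univ.erase (m.select T δ.1 y₁ δ.2.1),
        ind (T x' δ.1 y (δ.2.1 l)) * ind (δ.2.2 l = δ.2.2 (m.select T δ.1 y₁ δ.2.1)) := by
    intro x x' δ
    simp only [← Finset.sum_add_distrib, ← mul_add]
    refine Finset.sum_le_sum fun y _ => Finset.sum_le_sum fun y₁ _ =>
      mul_le_mul_of_nonneg_left ?_ (m.W_nonneg _ _ _ _)
    set k := m.select T δ.1 y₁ δ.2.1
    have h1 : ∀ l, ind (T x' δ.1 y (δ.2.1 l)) * ind (δ.2.2 l = δ.2.2 k) =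
        ind (δ.2.2 l = δ.2.2 k ∧ T x' δ.1 y (δ.2.1 l)) := by
      intro l
      by_cases h : δ.2.2 l = δ.2.2 k
      · rw [ind_true h, mul_one]; congr 1; simp [h]
      · rw [ind_false h, mul_zero, ind_false fun h' => h h'.1]
    simp only [h1]
    refine le_trans ?_ (add_le_add le_rfl (ind_exists_le _ _))
    refine le_trans (ind_mono ?_) (ind_or_le _ _)
    rintro ⟨l, hl⟩
    by_cases h : l = k
    · subst h; exact Or.inl hl.2
    · exact Or.inr ⟨l, by simp [h], hl⟩
  have hκA : ∀ x, ∑ x', m.p x' * ∑ δ : StateBook A₁ C L S, m.bookWeight δ *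
      ∑ y, ∑ y₁, m.W x δ.1 y y₁ * ind (T x' δ.1 y (δ.2.1 (m.select T δ.1 y₁ δ.2.1))) ≤ κA := by
    intro x
    calc _ = ∑ δ : StateBook A₁ C L S, m.bookWeight δ * ∑ y, ∑ y₁, m.W x δ.1 y y₁ *
          ∑ x', m.p x' * ind (T x' δ.1 y (δ.2.1 (m.select T δ.1 y₁ δ.2.1))) := by
          simp only [Finset.mul_sum]
          rw [Finset.sum_comm]
          refine Finset.sum_congr rfl fun δ _ => ?_
          rw [Finset.sum_comm]
          refine Finset.sum_congr rfl fun y _ => ?_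
          rw [Finset.sum_comm]
          refine Finset.sum_congr rfl fun y₁ _ => Finset.sum_congr rfl fun x' _ => by ring
      _ ≤ ∑ δ : StateBook A₁ C L S, m.bookWeight δ * ∑ y, ∑ y₁, m.W x δ.1 y y₁ * κA :=
          Finset.sum_le_sum fun δ _ => mul_le_mul_of_nonneg_left (Finset.sum_le_sum fun y _ =>
            Finset.sum_le_sum fun y₁ _ => mul_le_mul_of_nonneg_left (hA _ _ _)
              (m.W_nonneg _ _ _ _)) (m.bookWeight_nonneg _)
      _ = κA := by
          simp only [← Finset.sum_mul, m.sum_W, one_mul, m.sum_bookWeight hS]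
  have hκB : ∑ x, m.p x * ∑ x', m.p x' * ∑ δ : StateBook A₁ C L S, m.bookWeight δ *
      ∑ y, ∑ y₁, m.W x δ.1 y y₁ * ∑ l ∈ Finset.univ.erase (m.select T δ.1 y₁ δ.2.1),
        ind (T x' δ.1 y (δ.2.1 l)) * ind (δ.2.2 l = δ.2.2 (m.select T δ.1 y₁ δ.2.1)) ≤
      L / S * κB := by
    -- averaging over the bins
    have h1 : ∀ x x' x₁ (v : Fin L → C), ∑ β : Fin L → Fin S, (∏ _l : Fin L, (S : ℝ)⁻¹) *
        ∑ y, ∑ y₁, m.W x x₁ y y₁ * ∑ l ∈ Finset.univ.erase (m.select T x₁ y₁ v),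
          ind (T x' x₁ y (v l)) * ind (β l = β (m.select T x₁ y₁ v)) ≤
        (S : ℝ)⁻¹ * ∑ y, m.outGivenInputs x x₁ y * ∑ l, ind (T x' x₁ y (v l)) := by
      intro x x' x₁ v
      have h2 : ∀ k l : Fin L, l ≠ k → ∑ β : Fin L → Fin S, (∏ _l : Fin L, (S : ℝ)⁻¹) *
          ind (β l = β k) = (S : ℝ)⁻¹ := by
        intro k l hlk
        rw [sum_pi_marginal₂ (f := fun _ : Fin S => (S : ℝ)⁻¹) (sum_uniform hS) hlk.symm
          fun a b => ind (a = b)]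
        have : ∀ a : Fin S, ∑ b, (S : ℝ)⁻¹ * ind (a = b) = (S : ℝ)⁻¹ := by
          intro a
          rw [Finset.sum_eq_single a, ind_true rfl, mul_one]
          · intro b _ hb; rw [ind_false hb.symm, mul_zero]
          · simp
        simp only [this, ← Finset.sum_mul, sum_uniform hS, one_mul]
      calc _ = ∑ y, ∑ y₁, m.W x x₁ y y₁ * ∑ l ∈ Finset.univ.erase (m.select T x₁ y₁ v),
            ind (T x' x₁ y (v l)) * ∑ β : Fin L → Fin S, (∏ _l : Fin L, (S : ℝ)⁻¹) *
              ind (β l = β (m.select T x₁ y₁ v)) := by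
            simp only [Finset.mul_sum]
            rw [Finset.sum_comm]
            refine Finset.sum_congr rfl fun y _ => ?_
            rw [Finset.sum_comm]
            refine Finset.sum_congr rfl fun y₁ _ => ?_
            rw [Finset.sum_comm]
            refine Finset.sum_congr rfl fun l _ => Finset.sum_congr rfl fun β _ => by ring
        _ = ∑ y, ∑ y₁, m.W x x₁ y y₁ * ∑ l ∈ Finset.univ.erase (m.select T x₁ y₁ v),
            ind (T x' x₁ y (v l)) * (S : ℝ)⁻¹ := by
            refine Finset.sum_congr rfl fun y _ => Finset.sum_congr rfl fun y₁ _ => ?_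
            congr 1
            exact Finset.sum_congr rfl fun l hl => by rw [h2 _ _ (Finset.ne_of_mem_erase hl)]
        _ ≤ ∑ y, ∑ y₁, m.W x x₁ y y₁ * ∑ l, ind (T x' x₁ y (v l)) * (S : ℝ)⁻¹ :=
            Finset.sum_le_sum fun y _ => Finset.sum_le_sum fun y₁ _ =>
              mul_le_mul_of_nonneg_left (Finset.sum_le_sum_of_subset_of_nonneg
                (Finset.erase_subset _ _) fun l _ _ => mul_nonneg (ind_nonneg _) (by positivity))
                (m.W_nonneg _ _ _ _)
        _ = _ := by
            simp only [← Finset.sum_mul, outGivenInputs, ← mul_assoc]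
            rw [mul_comm]
    -- averaging over the codewords
    have h3 : ∀ x x' x₁, ∑ v : Fin L → C, (∏ l, m.compLaw x₁ (v l)) *
        ((S : ℝ)⁻¹ * ∑ y, m.outGivenInputs x x₁ y * ∑ l, ind (T x' x₁ y (v l))) =
        L / S * ∑ y, m.outGivenInputs x x₁ y * ∑ c, m.compLaw x₁ c * ind (T x' x₁ y c) := by
      intro x x' x₁
      calc _ = (S : ℝ)⁻¹ * ∑ y, m.outGivenInputs x x₁ y * ∑ l : Fin L,
            ∑ v : Fin L → C, (∏ l, m.compLaw x₁ (v l)) * ind (T x' x₁ y (v l)) := by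
            simp only [Finset.mul_sum]
            rw [Finset.sum_comm]
            refine Finset.sum_congr rfl fun y _ => ?_
            rw [Finset.sum_comm]
            refine Finset.sum_congr rfl fun l _ => Finset.sum_congr rfl fun v _ => by ring
        _ = _ := by
            have h4 : ∀ y, ∑ l : Fin L, ∑ v : Fin L → C, (∏ l, m.compLaw x₁ (v l)) *
                ind (T x' x₁ y (v l)) = L * ∑ c, m.compLaw x₁ c * ind (T x' x₁ y c) := by
              intro y
              rw [Finset.sum_congr rfl fun l _ =>
                sum_pi_marginal (m.sum_compLaw x₁) l fun c => ind (T x' x₁ y c)]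
              simp
            simp only [h4]
            rw [div_eq_mul_inv, mul_comm (L : ℝ), mul_assoc, Finset.mul_sum (a := (L : ℝ))]
            congr 1
            exact Finset.sum_congr rfl fun y _ => by ring
    calc _ ≤ ∑ x, m.p x * ∑ x', m.p x' * ∑ x₁, m.p₁ x₁ *
          (L / S * ∑ y, m.outGivenInputs x x₁ y * ∑ c, m.compLaw x₁ c * ind (T x' x₁ y c)) := by
          refine Finset.sum_le_sum fun x _ => mul_le_mul_of_nonneg_left
            (Finset.sum_le_sum fun x' _ => mul_le_mul_of_nonneg_left ?_ (m.p_nonneg _))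
              (m.p_nonneg _)
          rw [sum_bookWeight_mul]
          refine Finset.sum_le_sum fun x₁ _ => mul_le_mul_of_nonneg_left ?_ (m.p₁_nonneg _)
          rw [← h3]
          exact Finset.sum_le_sum fun v _ => mul_le_mul_of_nonneg_left (h1 x x' x₁ v)
            (Finset.prod_nonneg fun _ _ => m.compLaw_nonneg _ _)
      _ = L / S * ∑ x₁, m.p₁ x₁ * ∑ x', m.p x' * ∑ y, m.outLaw x₁ y *
            ∑ c, m.compLaw x₁ c * ind (T x' x₁ y c) := by
          simp only [outLaw, Finset.sum_mul]
          simp only [Finset.mul_sum (s := (Finset.univ : Finset A)),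
            Finset.mul_sum (s := (Finset.univ : Finset A₁)),
            Finset.mul_sum (s := (Finset.univ : Finset B))]
          rw [Finset.sum_comm]
          have : ∀ x', ∑ x, ∑ x₁, ∑ y, m.p x * (m.p x' * (m.p₁ x₁ * (L / S *
              (m.outGivenInputs x x₁ y * ∑ c, m.compLaw x₁ c * ind (T x' x₁ y c))))) =
              ∑ x₁, ∑ y, ∑ x, m.p x * (m.p x' * (m.p₁ x₁ * (L / S *
              (m.outGivenInputs x x₁ y * ∑ c, m.compLaw x₁ c * ind (T x' x₁ y c))))) := by
            intro x'
            rw [Finset.sum_comm]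
            exact Finset.sum_congr rfl fun x₁ _ => Finset.sum_comm
          simp only [this]
          rw [Finset.sum_comm]
          refine Finset.sum_congr rfl fun _ _ => Finset.sum_congr rfl fun _ _ =>
            Finset.sum_congr rfl fun _ _ => Finset.sum_congr rfl fun _ _ => by ring
      _ ≤ L / S * ∑ x₁, m.p₁ x₁ * κB :=
          mul_le_mul_of_nonneg_left (Finset.sum_le_sum fun x₁ _ =>
            mul_le_mul_of_nonneg_left (hB x₁) (m.p₁_nonneg _)) (by positivity)
      _ = _ := by rw [← Finset.sum_mul, m.sum_p₁, one_mul]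
  calc _ ≤ ∑ x, m.p x * ∑ x', m.p x' * ∑ δ : StateBook A₁ C L S, m.bookWeight δ *
        ((∑ y, ∑ y₁, m.W x δ.1 y y₁ * ind (T x' δ.1 y (δ.2.1 (m.select T δ.1 y₁ δ.2.1)))) +
        ∑ y, ∑ y₁, m.W x δ.1 y y₁ * ∑ l ∈ Finset.univ.erase (m.select T δ.1 y₁ δ.2.1),
        ind (T x' δ.1 y (δ.2.1 l)) * ind (δ.2.2 l = δ.2.2 (m.select T δ.1 y₁ δ.2.1))) :=
        Finset.sum_le_sum fun x _ => mul_le_mul_of_nonneg_left (Finset.sum_le_sum fun x' _ =>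
          mul_le_mul_of_nonneg_left (Finset.sum_le_sum fun δ _ => mul_le_mul_of_nonneg_left
            (hF x x' δ) (m.bookWeight_nonneg _)) (m.p_nonneg _)) (m.p_nonneg _)
    _ ≤ _ := by
        simp only [mul_add, Finset.sum_add_distrib]
        refine add_le_add ?_ (by simpa using hκB)
        calc _ ≤ ∑ x, m.p x * κA :=
              Finset.sum_le_sum fun x _ => mul_le_mul_of_nonneg_left (hκA x) (m.p_nonneg _)
          _ = κA := by rw [← Finset.sum_mul, m.sum_p, one_mul]

end Model

end RandomCode

/-! ### Averaging over codebooks -/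

section RandomCode

variable {A A₁ B B₁ C : Type*} [Fintype A] [Fintype A₁] [Fintype B] [Fintype B₁] [Fintype C]
variable (m : Model A A₁ B B₁ C) {M S S' L : ℕ}

namespace Model

/-- The block code of a codebook. The destination takes as the present state one whose relay input
passes the test `U` with the output, and as the message one whose codeword passes the test `T` with
the output, the relay input and some compression codeword of the bin named by the next state. -/
def bookCode [Nonempty (Fin M)] [Nonempty (Fin S)] [Nonempty (Fin L)] (U : A₁ → B → Prop)
    (T : A → A₁ → B → C → Prop) (cx : Fin M → A) (d : Fin S → StateBook A₁ C L S') :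
    BlockCode A A₁ B B₁ M S S' where
  enc := cx
  relay s := (d s).1
  next s y₁ := (d s).2.2 (m.select T (d s).1 y₁ (d s).2.1)
  decState y := Classical.epsilon fun s => U (d s).1 y
  decMsg s s' y := Classical.epsilon fun w =>
    ∃ l, (d s).2.2 l = s' ∧ T (cx w) (d s).1 y ((d s).2.1 l)

lemma sum_W_mul_mono (x : A) (x₁ : A₁) {f g : B → B₁ → ℝ} (h : ∀ y y₁, f y y₁ ≤ g y y₁) :
    ∑ y, ∑ y₁, m.W x x₁ y y₁ * f y y₁ ≤ ∑ y, ∑ y₁, m.W x x₁ y y₁ * g y y₁ :=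
  Finset.sum_le_sum fun _ _ => Finset.sum_le_sum fun _ _ =>
    mul_le_mul_of_nonneg_left (h _ _) (m.W_nonneg _ _ _ _)

lemma bookCode_err_le [Nonempty (Fin M)] [Nonempty (Fin S)] [Nonempty (Fin L)]
    (U : A₁ → B → Prop) (T : A → A₁ → B → C → Prop) (cx : Fin M → A)
    (d : Fin S → StateBook A₁ C L S') (s : Fin S) (w : Fin M) :
    (m.bookCode U T cx d).err m.W s w ≤
      (∑ y, ∑ y₁, m.W (cx w) (d s).1 y y₁ * (ind (¬U (d s).1 y) +
        ind (¬T (cx w) (d s).1 y ((d s).2.1 (m.select T (d s).1 y₁ (d s).2.1))))) +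
      (∑ s' ∈ Finset.univ.erase s, ∑ y, ∑ y₁, m.W (cx w) (d s).1 y y₁ * ind (U (d s').1 y)) +
      ∑ w' ∈ Finset.univ.erase w, ∑ y, ∑ y₁, m.W (cx w) (d s).1 y y₁ *
        ind (∃ l, (d s).2.2 l = (d s).2.2 (m.select T (d s).1 y₁ (d s).2.1) ∧
          T (cx w') (d s).1 y ((d s).2.1 l)) := by
  have h : ∀ y y₁, ind ((m.bookCode U T cx d).Fails s w y y₁) ≤
      (ind (¬U (d s).1 y) +
        ind (¬T (cx w) (d s).1 y ((d s).2.1 (m.select T (d s).1 y₁ (d s).2.1)))) +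
      (∑ s' ∈ Finset.univ.erase s, ind (U (d s').1 y)) +
      ∑ w' ∈ Finset.univ.erase w,
        ind (∃ l, (d s).2.2 l = (d s).2.2 (m.select T (d s).1 y₁ (d s).2.1) ∧
          T (cx w') (d s).1 y ((d s).2.1 l)) := by
    intro y y₁
    have h1 : ind ((m.bookCode U T cx d).decState y ≠ s) ≤
        ind (¬U (d s).1 y) + ∑ s' ∈ Finset.univ.erase s, ind (U (d s').1 y) := by
      refine le_trans ?_ (add_le_add le_rfl (ind_exists_le _ _))
      refine le_trans (ind_mono fun h => ?_) (ind_or_le _ _)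
      rcases epsilon_ne_imp h with h | ⟨j, hj, h⟩
      · exact Or.inl h
      · exact Or.inr ⟨j, by simp [hj], h⟩
    have h2 : ind ((m.bookCode U T cx d).decMsg s ((m.bookCode U T cx d).next s y₁) y ≠ w) ≤
        ind (¬T (cx w) (d s).1 y ((d s).2.1 (m.select T (d s).1 y₁ (d s).2.1))) +
        ∑ w' ∈ Finset.univ.erase w,
          ind (∃ l, (d s).2.2 l = (d s).2.2 (m.select T (d s).1 y₁ (d s).2.1) ∧
            T (cx w') (d s).1 y ((d s).2.1 l)) := by
      refine le_trans ?_ (add_le_add le_rfl (ind_exists_le _ _))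
      refine le_trans (ind_mono fun h => ?_) (ind_or_le _ _)
      rcases epsilon_ne_imp h with h | ⟨j, hj, h⟩
      · exact Or.inl fun h' => h ⟨_, rfl, h'⟩
      · exact Or.inr ⟨j, by simp [hj], h⟩
    have h3 := ind_or_le ((m.bookCode U T cx d).decState y ≠ s)
      ((m.bookCode U T cx d).decMsg s ((m.bookCode U T cx d).next s y₁) y ≠ w)
    unfold BlockCode.Fails
    linarith
  refine (m.sum_W_mul_mono _ _ h).trans_eq ?_
  have hsw : ∀ {ι : Type} (t : Finset ι) (f : ι → B → B₁ → ℝ),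
      ∑ y, ∑ y₁, ∑ i ∈ t, f i y y₁ = ∑ i ∈ t, ∑ y, ∑ y₁, f i y y₁ := by
    intro ι t f
    exact (Finset.sum_congr rfl fun y _ => Finset.sum_comm).trans Finset.sum_comm
  simp only [mul_add, Finset.sum_add_distrib, Finset.mul_sum]
  rw [hsw, hsw]
  rfl

/-- The random coding bound: the error probability averaged over the codebooks is small, so some
codebook has small error on average over states and messages, and expurgation of the states makes
it small in every state that remains. -/
theorem exists_blockCode (hM : 0 < M) (hS : 0 < S) (hS' : 0 < S') (hL : 0 < L)
    (hSS : S' ≤ S / 2 + 1) {U : A₁ → B → Prop} {T : A → A₁ → B → C → Prop}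
    {t γ κ κA κB ε : ℝ} (ht : 0 < t) (hγ : 0 < γ) (hε : 0 < ε)
    (hU : ∑ x₁, m.p₁ x₁ * ∑ y, m.outMarginal y * ind (U x₁ y) ≤ κ)
    (hA : ∀ x₁ y c, ∑ x, m.p x * ind (T x x₁ y c) ≤ κA)
    (hB : ∀ x₁, ∑ x, m.p x * ∑ y, m.outLaw x₁ y * ∑ c, m.compLaw x₁ c * ind (T x x₁ y c) ≤ κB)
    (hbound : m.expect (fun _ x₁ y _ _ => ind (¬U x₁ y)) + (t +
      m.expect (fun x x₁ y _ c => ind (¬T x x₁ y c)) / t +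
      m.expect (fun _ x₁ _ y₁ c => ind (γ * m.compLaw x₁ c < m.V x₁ y₁ c)) +
      Real.exp (-(L / γ))) + (S - 1) * κ + (M - 1) * (κA + L / S' * κB) ≤ ε) :
    ∃ b : BlockCode A A₁ B B₁ M S' S', ∀ s, ∑ w, b.err m.W s w ≤ M * (2 * ε) := by
  classical
  have : Nonempty (Fin M) := ⟨⟨0, hM⟩⟩
  have : Nonempty (Fin S) := ⟨⟨0, hS⟩⟩
  have : Nonempty (Fin S') := ⟨⟨0, hS'⟩⟩
  have : Nonempty (Fin L) := ⟨⟨0, hL⟩⟩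
  have hr1 : ∑ δ : StateBook A₁ C L S', m.bookWeight δ = 1 := m.sum_bookWeight hS'
  -- the three parts of the error, averaged over the codebooks
  have e1 : ∑ x, m.p x * ∑ δ : StateBook A₁ C L S', m.bookWeight δ *
      ∑ y, ∑ y₁, m.W x δ.1 y y₁ * (ind (¬U δ.1 y) +
        ind (¬T x δ.1 y (δ.2.1 (m.select T δ.1 y₁ δ.2.1)))) ≤
      m.expect (fun _ x₁ y _ _ => ind (¬U x₁ y)) + (t +
        m.expect (fun x x₁ y _ c => ind (¬T x x₁ y c)) / t +
        m.expect (fun _ x₁ _ y₁ c => ind (γ * m.compLaw x₁ c < m.V x₁ y₁ c)) +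
        Real.exp (-(L / γ))) := by
    simp only [mul_add, Finset.sum_add_distrib]
    refine add_le_add (le_of_eq ?_) ((le_of_eq ?_).trans (m.sum_select_fail_le T ht hγ))
    · rw [m.expect_input_output (fun _ x₁ y => ind (¬U x₁ y))]
      have h x := m.sum_bookWeight_mul_relay (L := L) hS' fun x₁ =>
        ∑ y, ∑ y₁, m.W x x₁ y y₁ * ind (¬U x₁ y)
      simp only [h]
      simp only [Finset.mul_sum (s := (Finset.univ : Finset A)),
        Finset.mul_sum (s := (Finset.univ : Finset A₁))]
      rw [Finset.sum_comm]
      exact Finset.sum_congr rfl fun _ _ => Finset.sum_congr rfl fun _ _ => by ring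
    · have h x := m.sum_bookWeight_mul_codewords (L := L) hS' fun x₁ v =>
        ∑ y, ∑ y₁, m.W x x₁ y y₁ * ind (¬T x x₁ y (v (m.select T x₁ y₁ v)))
      simp only [h]
      simp only [Finset.mul_sum (s := (Finset.univ : Finset A)),
        Finset.mul_sum (s := (Finset.univ : Finset A₁)),
        Finset.mul_sum (s := (Finset.univ : Finset (Fin L → C)))]
      rw [Finset.sum_comm]
      refine Finset.sum_congr rfl fun _ _ => ?_
      rw [Finset.sum_comm]
      exact Finset.sum_congr rfl fun _ _ => Finset.sum_congr rfl fun _ _ => by ring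
  have e2 : ∑ x, m.p x * ∑ δ : StateBook A₁ C L S', m.bookWeight δ *
      ∑ δ' : StateBook A₁ C L S', m.bookWeight δ' *
        ∑ y, ∑ y₁, m.W x δ.1 y y₁ * ind (U δ'.1 y) ≤ κ := by
    refine le_trans (le_of_eq ?_) hU
    have h1 : ∀ x, ∑ δ : StateBook A₁ C L S', m.bookWeight δ *
        ∑ δ' : StateBook A₁ C L S', m.bookWeight δ' *
          ∑ y, ∑ y₁, m.W x δ.1 y y₁ * ind (U δ'.1 y) =
        ∑ x₁, m.p₁ x₁ * ∑ x₁', m.p₁ x₁' * ∑ y, ∑ y₁, m.W x x₁ y y₁ * ind (U x₁' y) := by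
      intro x
      rw [← m.sum_bookWeight_mul_relay (L := L) hS']
      refine Finset.sum_congr rfl fun δ _ => ?_
      rw [m.sum_bookWeight_mul_relay hS' fun x₁' => ∑ y, ∑ y₁, m.W x δ.1 y y₁ * ind (U x₁' y)]
    simp only [h1]
    simp only [← Finset.sum_mul, outMarginal, outLaw, outGivenInputs]
    simp only [Finset.mul_sum (s := (Finset.univ : Finset A)),
      Finset.mul_sum (s := (Finset.univ : Finset A₁)),
      Finset.mul_sum (s := (Finset.univ : Finset B)), Finset.sum_mul (s := (Finset.univ : Finset A)),
      Finset.sum_mul (s := (Finset.univ : Finset A₁))]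
    have hr : ∀ F : A → A₁ → A₁ → B → ℝ, ∑ x, ∑ x₁, ∑ x₁', ∑ y, F x x₁ x₁' y =
        ∑ x₁', ∑ y, ∑ x₁, ∑ x, F x x₁ x₁' y := by
      intro F
      have h2 : ∀ x₁, ∑ x, ∑ x₁', ∑ y, F x x₁ x₁' y = ∑ x₁', ∑ y, ∑ x, F x x₁ x₁' y := fun x₁ => by
        rw [Finset.sum_comm]
        exact Finset.sum_congr rfl fun _ _ => Finset.sum_comm
      rw [Finset.sum_comm]
      simp only [h2]
      rw [Finset.sum_comm]
      exact Finset.sum_congr rfl fun _ _ => Finset.sum_comm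
    rw [hr]
    exact Finset.sum_congr rfl fun _ _ => Finset.sum_congr rfl fun _ _ =>
      Finset.sum_congr rfl fun _ _ => Finset.sum_congr rfl fun _ _ => by ring
  have e3 := m.sum_wrong_message_le (L := L) hS' hA hB
  -- the average over the codebooks, for a fixed state and message
  have havg : ∀ s w, ∑ cx : Fin M → A, (∏ i, m.p (cx i)) *
      ∑ d : Fin S → StateBook A₁ C L S', (∏ i, m.bookWeight (d i)) *
        (m.bookCode U T cx d).err m.W s w ≤ ε := by
    intro s w
    refine le_trans ?_ hbound
    refine (Finset.sum_le_sum fun cx _ => mul_le_mul_of_nonneg_left (Finset.sum_le_sum fun d _ =>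
      mul_le_mul_of_nonneg_left (m.bookCode_err_le U T cx d s w)
        (Finset.prod_nonneg fun _ _ => m.bookWeight_nonneg _))
        (Finset.prod_nonneg fun _ _ => m.p_nonneg _)).trans ?_
    simp only [mul_add (∏ i, m.bookWeight _), Finset.sum_add_distrib, mul_add (∏ i, m.p _)]
    refine add_le_add (add_le_add ?_ ?_) ?_
    · refine le_trans (le_of_eq ?_) e1
      rw [← sum_pi_marginal m.sum_p w]
      refine Finset.sum_congr rfl fun cx _ => ?_
      rw [← sum_pi_marginal hr1 s]
    · have h2 : ∀ s' ∈ Finset.univ.erase s, ∑ cx : Fin M → A, (∏ i, m.p (cx i)) *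
          ∑ d : Fin S → StateBook A₁ C L S', (∏ i, m.bookWeight (d i)) *
            ∑ y, ∑ y₁, m.W (cx w) (d s).1 y y₁ * ind (U (d s').1 y) ≤ κ := by
        intro s' hs'
        refine le_trans (le_of_eq ?_) e2
        rw [← sum_pi_marginal m.sum_p w]
        refine Finset.sum_congr rfl fun cx _ => ?_
        rw [← sum_pi_marginal₂ hr1 (Finset.ne_of_mem_erase hs')]
      have h3 := Finset.sum_le_sum h2
      rw [Finset.sum_const, Finset.card_erase_of_mem (Finset.mem_univ s), Finset.card_univ,
        Fintype.card_fin, nsmul_eq_mul, Nat.cast_sub hS, Nat.cast_one] at h3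
      refine le_trans (le_of_eq ?_) h3
      rw [Finset.sum_comm]
      refine Finset.sum_congr rfl fun cx _ => ?_
      rw [← Finset.mul_sum, Finset.sum_comm]
      simp only [Finset.mul_sum (s := Finset.univ.erase s)]
    · have h2 : ∀ w' ∈ Finset.univ.erase w, ∑ cx : Fin M → A, (∏ i, m.p (cx i)) *
          ∑ d : Fin S → StateBook A₁ C L S', (∏ i, m.bookWeight (d i)) *
            ∑ y, ∑ y₁, m.W (cx w) (d s).1 y y₁ *
              ind (∃ l, (d s).2.2 l = (d s).2.2 (m.select T (d s).1 y₁ (d s).2.1) ∧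
                T (cx w') (d s).1 y ((d s).2.1 l)) ≤ κA + L / S' * κB := by
        intro w' hw'
        refine le_trans (le_of_eq ?_) e3
        rw [← sum_pi_marginal₂ m.sum_p (Finset.ne_of_mem_erase hw')]
        refine Finset.sum_congr rfl fun cx _ => ?_
        rw [← sum_pi_marginal hr1 s]
      have h3 := Finset.sum_le_sum h2
      rw [Finset.sum_const, Finset.card_erase_of_mem (Finset.mem_univ w), Finset.card_univ,
        Fintype.card_fin, nsmul_eq_mul, Nat.cast_sub hM, Nat.cast_one] at h3
      refine le_trans (le_of_eq ?_) h3
      rw [Finset.sum_comm]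
      refine Finset.sum_congr rfl fun cx _ => ?_
      rw [← Finset.mul_sum, Finset.sum_comm]
      simp only [Finset.mul_sum (s := Finset.univ.erase w)]
  -- a good codebook
  obtain ⟨cx, d, hcd⟩ : ∃ cx : Fin M → A, ∃ d : Fin S → StateBook A₁ C L S',
      ∑ s, ∑ w, (m.bookCode U T cx d).err m.W s w ≤ S * (M * ε) := by
    have h1 : ∑ cx : Fin M → A, (∏ i, m.p (cx i)) *
        ∑ d : Fin S → StateBook A₁ C L S', (∏ i, m.bookWeight (d i)) *
          ∑ s, ∑ w, (m.bookCode U T cx d).err m.W s w ≤ S * (M * ε) := by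
      have h2 := Finset.sum_le_sum fun s (_ : s ∈ (Finset.univ : Finset (Fin S))) =>
        Finset.sum_le_sum fun w (_ : w ∈ (Finset.univ : Finset (Fin M))) => havg s w
      simp only [Finset.sum_const, Finset.card_univ, Fintype.card_fin, nsmul_eq_mul] at h2
      refine le_trans (le_of_eq ?_) h2
      simp only [Finset.mul_sum]
      have hsw : ∀ F : (Fin M → A) → (Fin S → StateBook A₁ C L S') → Fin S → Fin M → ℝ,
          ∑ cx, ∑ d, ∑ s, ∑ w, F cx d s w = ∑ s, ∑ w, ∑ cx, ∑ d, F cx d s w := by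
        intro F
        have h3 : ∀ cx, ∑ d, ∑ s, ∑ w, F cx d s w = ∑ s, ∑ w, ∑ d, F cx d s w := fun cx => by
          rw [Finset.sum_comm]
          exact Finset.sum_congr rfl fun _ _ => Finset.sum_comm
        simp only [h3]
        rw [Finset.sum_comm]
        exact Finset.sum_congr rfl fun _ _ => Finset.sum_comm
      rw [hsw]
    obtain ⟨cx, h⟩ := exists_le_of_weighted_sum_le
      (fun cx : Fin M → A => Finset.prod_nonneg fun i _ => m.p_nonneg (cx i))
      (sum_pi_weight m.sum_p) h1
    obtain ⟨d, h⟩ := exists_le_of_weighted_sum_le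
      (fun d : Fin S → StateBook A₁ C L S' =>
        Finset.prod_nonneg fun i _ => m.bookWeight_nonneg (d i))
      (sum_pi_weight hr1) h
    exact ⟨cx, d, h⟩
  -- the states with small error
  set b := m.bookCode U T cx d
  have hM' : (0 : ℝ) < M := by exact_mod_cast hM
  obtain ⟨f, hf⟩ := exists_embedding_le_two_mul (N := S') (e := fun s => ∑ w, b.err m.W s w)
    (ε := M * ε) (fun s => Finset.sum_nonneg fun w _ => Finset.sum_nonneg fun y _ =>
      Finset.sum_nonneg fun y₁ _ => mul_nonneg (m.W_nonneg _ _ _ _) (ind_nonneg _))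
    (by positivity) (by simpa using hcd) (by simpa using hSS)
  refine ⟨⟨b.enc, fun s => b.relay (f s), fun s => b.next (f s),
    fun y => Function.invFun f (b.decState y), fun s => b.decMsg (f s)⟩, fun s => ?_⟩
  refine le_trans (Finset.sum_le_sum fun w _ => ?_) ((hf s).trans_eq (by ring))
  refine m.sum_W_mul_mono _ _ fun y y₁ => ind_mono ?_
  rintro (h | h)
  · refine Or.inl fun h' => h ?_
    simp only [h']
    exact Function.leftInverse_invFun f.injective s
  · exact Or.inr h

end Model

end RandomCode

/-! ### Memoryless extensions and large deviations -/

section Asymptotics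

/-- Chernoff bound for independent samples `z i` from `P`: a product of ratios `a / b` hardly ever
falls short of its typical exponential growth. -/
lemma tendsto_prob_prod_le {Z : Type*} [Fintype Z] {P a b : Z → ℝ} (hP : ∀ z, 0 ≤ P z)
    (hP1 : ∑ z, P z = 1) (ha : ∀ z, 0 < P z → 0 < a z) (hb : ∀ z, 0 < P z → 0 < b z) {δ I : ℝ}
    (hδ : 0 < δ) (hI : I = ∑ z, P z * Real.logb 2 (a z / b z)) :
    Tendsto (fun k : ℕ => ∑ z : Fin k → Z, (∏ i, P (z i)) *
      ind (∏ i, a (z i) ≤ 2 ^ ((k : ℝ) * (I - δ)) * ∏ i, b (z i))) atTop (𝓝 0) := by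
  have hl2 : 0 < Real.log 2 := Real.log_pos (by norm_num)
  set h : Z → ℝ := fun z => Real.log (b z) - Real.log (a z) + (I - δ) * Real.log 2
  set φ : ℝ → ℝ := fun r => ∑ z, P z * Real.exp (r * h z)
  have hmean : ∑ z, P z * h z < 0 := by
    have h1 : ∀ z, P z * h z = P z * ((I - δ) * Real.log 2) -
        (P z * Real.logb 2 (a z / b z)) * Real.log 2 := by
      intro z
      rcases (hP z).eq_or_lt with hz | hz
      · simp [← hz]
      · have : Real.logb 2 (a z / b z) * Real.log 2 = Real.log (a z) - Real.log (b z) := by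
          rw [Real.logb, div_mul_cancel₀ _ hl2.ne',
            Real.log_div (ha z hz).ne' (hb z hz).ne']
        rw [mul_assoc, this]; simp only [h]; ring
    simp only [h1]
    rw [Finset.sum_sub_distrib, ← Finset.sum_mul, ← Finset.sum_mul, hP1, ← hI]
    nlinarith
  have hderiv : HasDerivAt φ (∑ z, P z * h z) 0 := by
    have : ∀ z ∈ (Finset.univ : Finset Z),
        HasDerivAt (fun r : ℝ => P z * Real.exp (r * h z)) (P z * h z) 0 := by
      intro z _
      have h1 : HasDerivAt (fun r : ℝ => r * h z) (h z) 0 := by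
        simpa using (hasDerivAt_id (0 : ℝ)).mul_const (h z)
      simpa using h1.exp.const_mul (P z)
    exact HasDerivAt.fun_sum this
  obtain ⟨r, hr0, hr1⟩ : ∃ r, 0 < r ∧ φ r < 1 := by
    have h1 := (hasDerivAt_iff_tendsto_slope.mp hderiv).eventually (gt_mem_nhds hmean)
    have h2 : ∀ᶠ r in 𝓝[>] (0 : ℝ), slope φ 0 r < 0 :=
      h1.filter_mono (nhdsWithin_mono _ fun x hx => ne_of_gt hx)
    obtain ⟨r, hs, hr⟩ := (h2.and self_mem_nhdsWithin).exists
    refine ⟨r, hr, ?_⟩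
    have hφ0 : φ 0 = 1 := by simp [φ, hP1]
    rw [slope_def_field, sub_zero, hφ0] at hs
    have := (div_neg_iff.mp hs).resolve_left fun h => absurd h.2 (not_lt.mpr (le_of_lt hr))
    linarith [this.1]
  have hφnn : 0 ≤ φ r := Finset.sum_nonneg fun z _ => mul_nonneg (hP z) (Real.exp_pos _).le
  refine squeeze_zero (fun k => Finset.sum_nonneg fun z _ =>
    mul_nonneg (Finset.prod_nonneg fun i _ => hP _) (ind_nonneg _)) (fun k => ?_)
    (tendsto_pow_atTop_nhds_zero_of_lt_one hφnn hr1)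
  have h2 : φ r ^ k = ∑ z : Fin k → Z, ∏ i, (P (z i) * Real.exp (r * h (z i))) := by
    rw [sum_pi_prod fun (_ : Fin k) z => P z * Real.exp (r * h z)]; simp [φ]
  rw [h2]
  refine Finset.sum_le_sum fun z _ => ?_
  rw [Finset.prod_mul_distrib]
  by_cases hz : ∀ i, 0 < P (z i)
  · refine mul_le_mul_of_nonneg_left ?_ (Finset.prod_nonneg fun i _ => hP _)
    by_cases hE : ∏ i, a (z i) ≤ 2 ^ ((k : ℝ) * (I - δ)) * ∏ i, b (z i)
    · rw [ind_true hE, ← Real.exp_sum, Real.one_le_exp_iff, ← Finset.mul_sum]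
      refine mul_nonneg hr0.le ?_
      have hA : 0 < ∏ i, a (z i) := Finset.prod_pos fun i _ => ha _ (hz i)
      have hB : 0 < ∏ i, b (z i) := Finset.prod_pos fun i _ => hb _ (hz i)
      have hlog := Real.log_le_log hA hE
      rw [Real.log_mul (by positivity) hB.ne', Real.log_rpow (by norm_num),
        Real.log_prod fun i _ => (ha _ (hz i)).ne',
        Real.log_prod fun i _ => (hb _ (hz i)).ne'] at hlog
      simp only [h, Finset.sum_add_distrib, Finset.sum_sub_distrib, Finset.sum_const,
        Finset.card_univ, Fintype.card_fin, nsmul_eq_mul]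
      linarith
    · rw [ind_false hE]; exact Finset.prod_nonneg fun i _ => (Real.exp_pos _).le
  · push Not at hz
    obtain ⟨i, hi⟩ := hz
    rw [Finset.prod_eq_zero (f := fun i => P (z i)) (Finset.mem_univ i) (le_antisymm hi (hP _))]
    simp

variable {A A₁ B B₁ C : Type*} [Fintype A] [Fintype A₁] [Fintype B] [Fintype B₁] [Fintype C]

namespace Model

variable (m : Model A A₁ B B₁ C)

/-- The `k`-fold memoryless extension. -/
def pow (k : ℕ) : Model (Fin k → A) (Fin k → A₁) (Fin k → B) (Fin k → B₁) (Fin k → C) where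
  p x := ∏ i, m.p (x i)
  p₁ x₁ := ∏ i, m.p₁ (x₁ i)
  W x x₁ y y₁ := ∏ i, m.W (x i) (x₁ i) (y i) (y₁ i)
  V x₁ y₁ c := ∏ i, m.V (x₁ i) (y₁ i) (c i)
  p_nonneg _ := Finset.prod_nonneg fun _ _ => m.p_nonneg _
  p₁_nonneg _ := Finset.prod_nonneg fun _ _ => m.p₁_nonneg _
  W_nonneg _ _ _ _ := Finset.prod_nonneg fun _ _ => m.W_nonneg _ _ _ _
  V_nonneg _ _ _ := Finset.prod_nonneg fun _ _ => m.V_nonneg _ _ _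
  sum_p := sum_pi_weight m.sum_p
  sum_p₁ := sum_pi_weight m.sum_p₁
  sum_W x x₁ := by
    have h : ∀ y : Fin k → B, ∑ y₁ : Fin k → B₁, ∏ i, m.W (x i) (x₁ i) (y i) (y₁ i) =
        ∏ i, ∑ y₁, m.W (x i) (x₁ i) (y i) y₁ := fun y =>
      sum_pi_prod fun i y₁ => m.W (x i) (x₁ i) (y i) y₁
    simp only [h]
    rw [sum_pi_prod fun i y => ∑ y₁, m.W (x i) (x₁ i) y y₁]
    simp [m.sum_W]
  sum_V x₁ y₁ := by
    rw [sum_pi_prod fun i c => m.V (x₁ i) (y₁ i) c]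
    simp [m.sum_V]

variable {k : ℕ}

lemma pow_outGivenInputs (x x₁ y) : (m.pow k).outGivenInputs x x₁ y =
    ∏ i, m.outGivenInputs (x i) (x₁ i) (y i) :=
  sum_pi_prod fun i y₁ => m.W (x i) (x₁ i) (y i) y₁

lemma pow_outLaw (x₁ y) : (m.pow k).outLaw x₁ y = ∏ i, m.outLaw (x₁ i) (y i) := by
  unfold outLaw
  simp only [pow_outGivenInputs]
  rw [← sum_pi_prod fun i x => m.p x * m.outGivenInputs x (x₁ i) (y i)]
  simp [pow, Finset.prod_mul_distrib]

lemma pow_outMarginal (y) : (m.pow k).outMarginal y = ∏ i, m.outMarginal (y i) := by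
  unfold outMarginal
  simp only [pow_outLaw]
  rw [← sum_pi_prod fun i x₁ => m.p₁ x₁ * m.outLaw x₁ (y i)]
  simp [pow, Finset.prod_mul_distrib]

lemma pow_relayOutLaw (x₁ y₁) : (m.pow k).relayOutLaw x₁ y₁ =
    ∏ i, m.relayOutLaw (x₁ i) (y₁ i) := by
  unfold relayOutLaw
  have h : ∀ x : Fin k → A, ∑ y, (m.pow k).W x x₁ y y₁ =
      ∏ i, ∑ y, m.W (x i) (x₁ i) y (y₁ i) := fun x =>
    sum_pi_prod fun i y => m.W (x i) (x₁ i) y (y₁ i)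
  simp only [h]
  rw [← sum_pi_prod fun i x => m.p x * ∑ y, m.W x (x₁ i) y (y₁ i)]
  simp [pow, Finset.prod_mul_distrib]

lemma pow_compLaw (x₁ c) : (m.pow k).compLaw x₁ c = ∏ i, m.compLaw (x₁ i) (c i) := by
  unfold compLaw
  simp only [pow_relayOutLaw]
  rw [← sum_pi_prod fun i y₁ => m.relayOutLaw (x₁ i) y₁ * m.V (x₁ i) y₁ (c i)]
  simp [pow, Finset.prod_mul_distrib]

lemma pow_pairGivenInputs (x x₁ y c) : (m.pow k).pairGivenInputs x x₁ y c =
    ∏ i, m.pairGivenInputs (x i) (x₁ i) (y i) (c i) := by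
  unfold pairGivenInputs
  rw [← sum_pi_prod fun i y₁ => m.W (x i) (x₁ i) (y i) y₁ * m.V (x₁ i) y₁ (c i)]
  simp [pow, Finset.prod_mul_distrib]

lemma pow_pairLaw (x₁ y c) : (m.pow k).pairLaw x₁ y c =
    ∏ i, m.pairLaw (x₁ i) (y i) (c i) := by
  unfold pairLaw
  simp only [pow_pairGivenInputs]
  rw [← sum_pi_prod fun i x => m.p x * m.pairGivenInputs x (x₁ i) (y i) (c i)]
  simp [pow, Finset.prod_mul_distrib]

lemma expect_pow (f : (Fin k → A) → (Fin k → A₁) → (Fin k → B) → (Fin k → B₁) → (Fin k → C) → ℝ) :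
    (m.pow k).expect f = ∑ z : Fin k → A × A₁ × B × B₁ × C, (∏ i, m.joint (z i)) *
      f (fun i => (z i).1) (fun i => (z i).2.1) (fun i => (z i).2.2.1) (fun i => (z i).2.2.2.1)
        (fun i => (z i).2.2.2.2) := by
  unfold expect
  let e : (Fin k → A × A₁ × B × B₁ × C) ≃
      (Fin k → A) × (Fin k → A₁) × (Fin k → B) × (Fin k → B₁) × (Fin k → C) :=
    { toFun := fun z => (fun i => (z i).1, fun i => (z i).2.1, fun i => (z i).2.2.1,
        fun i => (z i).2.2.2.1, fun i => (z i).2.2.2.2)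
      invFun := fun u i => (u.1 i, u.2.1 i, u.2.2.1 i, u.2.2.2.1 i, u.2.2.2.2 i)
      left_inv := fun _ => rfl
      right_inv := fun _ => rfl }
  rw [← Equiv.sum_comp e]
  refine Finset.sum_congr rfl fun z _ => ?_
  congr 1
  simp [joint, pow, e, Finset.prod_mul_distrib]

lemma sum_joint : ∑ z, m.joint z = 1 := by
  have h := m.expect_eq fun _ _ _ _ _ => 1
  simp only [mul_one, m.sum_V, m.sum_W, m.sum_p, m.sum_p₁] at h
  rw [← h]; simp [expect]

lemma pos_of_joint_pos {z : A × A₁ × B × B₁ × C} (h : 0 < m.joint z) :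
    0 < m.p z.1 ∧ 0 < m.p₁ z.2.1 ∧ 0 < m.W z.1 z.2.1 z.2.2.1 z.2.2.2.1 ∧
      0 < m.V z.2.1 z.2.2.2.1 z.2.2.2.2 := by
  have h1 := m.p_nonneg z.1
  have h2 := m.p₁_nonneg z.2.1
  have h3 := m.W_nonneg z.1 z.2.1 z.2.2.1 z.2.2.2.1
  have h4 := m.V_nonneg z.2.1 z.2.2.2.1 z.2.2.2.2
  have h0 := h.ne'
  unfold joint at h0
  simp only [mul_ne_zero_iff] at h0
  exact ⟨h1.lt_of_ne' h0.1.1.1, h2.lt_of_ne' h0.1.1.2, h3.lt_of_ne' h0.1.2, h4.lt_of_ne' h0.2⟩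

lemma outGivenInputs_pos {x x₁ y y₁} (h : 0 < m.W x x₁ y y₁) : 0 < m.outGivenInputs x x₁ y :=
  sum_pos_of_term (fun _ => m.W_nonneg _ _ _ _) h

lemma outLaw_pos {x x₁ y} (hp : 0 < m.p x) (h : 0 < m.outGivenInputs x x₁ y) :
    0 < m.outLaw x₁ y :=
  sum_pos_of_term (fun _ => mul_nonneg (m.p_nonneg _) (m.outGivenInputs_nonneg _ _ _))
    (mul_pos hp h)

lemma outMarginal_pos {x₁ y} (hp : 0 < m.p₁ x₁) (h : 0 < m.outLaw x₁ y) :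
    0 < m.outMarginal y :=
  sum_pos_of_term (fun _ => mul_nonneg (m.p₁_nonneg _) (m.outLaw_nonneg _ _)) (mul_pos hp h)

lemma relayOutLaw_pos {x x₁ y y₁} (hp : 0 < m.p x) (h : 0 < m.W x x₁ y y₁) :
    0 < m.relayOutLaw x₁ y₁ :=
  sum_pos_of_term (fun _ => mul_nonneg (m.p_nonneg _) (Finset.sum_nonneg fun _ _ =>
    m.W_nonneg _ _ _ _)) (mul_pos hp (sum_pos_of_term (fun _ => m.W_nonneg _ _ _ _) h))

lemma compLaw_pos {x₁ y₁ c} (h : 0 < m.relayOutLaw x₁ y₁) (hV : 0 < m.V x₁ y₁ c) :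
    0 < m.compLaw x₁ c :=
  sum_pos_of_term (fun _ => mul_nonneg (m.relayOutLaw_nonneg _ _) (m.V_nonneg _ _ _))
    (mul_pos h hV)

lemma pairGivenInputs_pos {x x₁ y y₁ c} (h : 0 < m.W x x₁ y y₁) (hV : 0 < m.V x₁ y₁ c) :
    0 < m.pairGivenInputs x x₁ y c :=
  sum_pos_of_term (fun _ => mul_nonneg (m.W_nonneg _ _ _ _) (m.V_nonneg _ _ _)) (mul_pos h hV)

lemma pairLaw_pos {x x₁ y c} (hp : 0 < m.p x) (h : 0 < m.pairGivenInputs x x₁ y c) :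
    0 < m.pairLaw x₁ y c :=
  sum_pos_of_term (fun _ => mul_nonneg (m.p_nonneg _) (m.pairGivenInputs_nonneg _ _ _ _))
    (mul_pos hp h)

lemma marginals_pos {x x₁ y y₁ c} (h : 0 < m.joint (x, x₁, y, y₁, c)) :
    0 < m.outGivenInputs x x₁ y ∧ 0 < m.outLaw x₁ y ∧ 0 < m.outMarginal y ∧
      0 < m.compLaw x₁ c ∧ 0 < m.pairGivenInputs x x₁ y c ∧ 0 < m.pairLaw x₁ y c := by
  obtain ⟨hp, hp1, hW, hV⟩ := m.pos_of_joint_pos h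
  have hg := m.outGivenInputs_pos hW
  have ho := m.outLaw_pos hp hg
  have hq := m.pairGivenInputs_pos hW hV
  exact ⟨hg, ho, m.outMarginal_pos hp1 ho, m.compLaw_pos (m.relayOutLaw_pos hp hW) hV, hq,
    m.pairLaw_pos hp hq⟩

/-! ### Threshold tests -/

lemma state_test_le {γ : ℝ} (hγ : 0 < γ) :
    ∑ x₁, m.p₁ x₁ * ∑ y, m.outMarginal y * ind (γ * m.outMarginal y < m.outLaw x₁ y) ≤ γ⁻¹ := by
  have h : ∀ x₁, ∑ y, m.outMarginal y * ind (γ * m.outMarginal y < m.outLaw x₁ y) ≤ γ⁻¹ := by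
    intro x₁
    rw [← mul_one γ⁻¹, ← m.sum_outLaw x₁, Finset.mul_sum]
    refine Finset.sum_le_sum fun y _ => ?_
    by_cases h : γ * m.outMarginal y < m.outLaw x₁ y
    · rw [ind_true h, mul_one, inv_mul_eq_div, le_div_iff₀ hγ]; linarith
    · rw [ind_false h, mul_zero]; exact mul_nonneg (inv_nonneg.mpr hγ.le) (m.outLaw_nonneg _ _)
  refine (Finset.sum_le_sum fun x₁ _ =>
    mul_le_mul_of_nonneg_left (h x₁) (m.p₁_nonneg _)).trans_eq ?_
  rw [← Finset.sum_mul, m.sum_p₁, one_mul]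

lemma message_test_le {γ : ℝ} (hγ : 0 < γ) (x₁ y c) :
    ∑ x, m.p x * ind (γ * m.pairLaw x₁ y c < m.pairGivenInputs x x₁ y c) ≤ γ⁻¹ := by
  rcases (m.pairLaw_nonneg x₁ y c).eq_or_lt with h0 | h0
  · refine (Finset.sum_nonpos fun x _ => ?_).trans (inv_nonneg.mpr hγ.le)
    have h1 : m.p x * m.pairGivenInputs x x₁ y c = 0 :=
      (Finset.sum_eq_zero_iff_of_nonneg fun x _ => mul_nonneg (m.p_nonneg x)
        (m.pairGivenInputs_nonneg x x₁ y c)).mp h0.symm x (Finset.mem_univ x)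
    rcases mul_eq_zero.mp h1 with h | h
    · rw [h, zero_mul]
    · rw [← h0, mul_zero, h, ind_false (lt_irrefl _), mul_zero]
  · have h1 : ∀ x, m.p x * ind (γ * m.pairLaw x₁ y c < m.pairGivenInputs x x₁ y c) ≤
        (m.p x * m.pairGivenInputs x x₁ y c) / (γ * m.pairLaw x₁ y c) := by
      intro x
      rw [mul_div_assoc]
      refine mul_le_mul_of_nonneg_left ?_ (m.p_nonneg x)
      by_cases h : γ * m.pairLaw x₁ y c < m.pairGivenInputs x x₁ y c
      · rw [ind_true h, one_le_div (by positivity)]; exact h.le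
      · rw [ind_false h]
        exact div_nonneg (m.pairGivenInputs_nonneg _ _ _ _) (by positivity)
    refine (Finset.sum_le_sum fun x _ => h1 x).trans_eq ?_
    rw [← Finset.sum_div, ← pairLaw]
    field_simp

lemma sum_pairGivenInputs (x x₁) : ∑ y, ∑ c, m.pairGivenInputs x x₁ y c = 1 := by
  rw [← m.sum_W x x₁]
  refine Finset.sum_congr rfl fun y _ => ?_
  unfold pairGivenInputs
  rw [Finset.sum_comm]
  refine Finset.sum_congr rfl fun y₁ _ => ?_
  rw [← Finset.mul_sum, m.sum_V, mul_one]

lemma independent_test_le {γ : ℝ} (hγ : 0 < γ) (x₁) :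
    ∑ x, m.p x * ∑ y, m.outLaw x₁ y * ∑ c, m.compLaw x₁ c *
      ind (γ * (m.outLaw x₁ y * m.compLaw x₁ c) < m.pairGivenInputs x x₁ y c) ≤ γ⁻¹ := by
  have h1 : ∀ x, ∑ y, m.outLaw x₁ y * ∑ c, m.compLaw x₁ c *
      ind (γ * (m.outLaw x₁ y * m.compLaw x₁ c) < m.pairGivenInputs x x₁ y c) ≤ γ⁻¹ := by
    intro x
    rw [← mul_one γ⁻¹, ← m.sum_pairGivenInputs x x₁, Finset.mul_sum]
    refine Finset.sum_le_sum fun y _ => ?_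
    rw [Finset.mul_sum, Finset.mul_sum]
    refine Finset.sum_le_sum fun c _ => ?_
    by_cases h : γ * (m.outLaw x₁ y * m.compLaw x₁ c) < m.pairGivenInputs x x₁ y c
    · rw [ind_true h, mul_one, inv_mul_eq_div, le_div_iff₀ hγ]; linarith
    · rw [ind_false h, mul_zero, mul_zero]
      exact mul_nonneg (inv_nonneg.mpr hγ.le) (m.pairGivenInputs_nonneg _ _ _ _)
  refine (Finset.sum_le_sum fun x _ =>
    mul_le_mul_of_nonneg_left (h1 x) (m.p_nonneg _)).trans_eq ?_
  rw [← Finset.sum_mul, m.sum_p, one_mul]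

/-! ### Information rates and the block code theorem -/

/-- `I(X₁; Y)`. -/
def stateRate : ℝ :=
  m.expect fun _ x₁ y _ _ => Real.logb 2 (m.outLaw x₁ y / m.outMarginal y)

/-- `I(Y₁; Ŷ₁ | X₁)`. -/
def compRate : ℝ :=
  m.expect fun _ x₁ _ y₁ c => Real.logb 2 (m.V x₁ y₁ c / m.compLaw x₁ c)

/-- `I(X; Y, Ŷ₁ | X₁)`. -/
def messageRate : ℝ :=
  m.expect fun x x₁ y _ c => Real.logb 2 (m.pairGivenInputs x x₁ y c / m.pairLaw x₁ y c)

/-- `I(X; Y | X₁) + I(Ŷ₁; X, Y | X₁)`. -/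
def jointRate : ℝ :=
  m.expect fun x x₁ y _ c =>
    Real.logb 2 (m.pairGivenInputs x x₁ y c / (m.outLaw x₁ y * m.compLaw x₁ c))

lemma tendsto_expect_pow {f : (k : ℕ) → (Fin k → A) → (Fin k → A₁) → (Fin k → B) → (Fin k → B₁) →
      (Fin k → C) → Prop} {a b : A → A₁ → B → B₁ → C → ℝ} {δ I : ℝ} (hδ : 0 < δ)
    (hI : I = m.expect fun x x₁ y y₁ c => Real.logb 2 (a x x₁ y y₁ c / b x x₁ y y₁ c))
    (ha : ∀ z, 0 < m.joint z → 0 < a z.1 z.2.1 z.2.2.1 z.2.2.2.1 z.2.2.2.2)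
    (hb : ∀ z, 0 < m.joint z → 0 < b z.1 z.2.1 z.2.2.1 z.2.2.2.1 z.2.2.2.2)
    (hf : ∀ k x x₁ y y₁ c, f k x x₁ y y₁ c →
      ∏ i, a (x i) (x₁ i) (y i) (y₁ i) (c i) ≤
        2 ^ ((k : ℝ) * (I - δ)) * ∏ i, b (x i) (x₁ i) (y i) (y₁ i) (c i)) :
    Tendsto (fun k => (m.pow k).expect fun x x₁ y y₁ c => ind (f k x x₁ y y₁ c)) atTop (𝓝 0) := by
  refine squeeze_zero (fun k => Finset.sum_nonneg fun z _ =>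
    mul_nonneg ((m.pow k).joint_nonneg z) (ind_nonneg _)) (fun k => ?_)
    (tendsto_prob_prod_le m.joint_nonneg m.sum_joint ha hb hδ hI)
  rw [expect_pow]
  exact Finset.sum_le_sum fun z _ => mul_le_mul_of_nonneg_left (ind_mono (hf k _ _ _ _ _))
    (Finset.prod_nonneg fun _ _ => m.joint_nonneg _)

end Model

end Asymptotics

namespace Model

variable {A A₁ B B₁ C : Type*} [Fintype A] [Fintype A₁] [Fintype B] [Fintype B₁] [Fintype C]
variable (m : Model A A₁ B B₁ C)

/-- Good block codes exist when the message rate is below `I(X; Y, Ŷ₁ | X₁)` and the compression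
rate `I(Y₁; Ŷ₁ | X₁)` can be served jointly by the bins, at rate `I(X₁; Y)`, and the
destination's own observation. -/
theorem eventually_exists_blockCode {R ε : ℝ} (hc : 0 ≤ m.compRate) (h1 : R < m.messageRate)
    (h2 : R + m.compRate < m.jointRate + m.stateRate) (hε : 0 < ε) :
    ∀ᶠ k : ℕ in atTop, ∃ S, 0 < S ∧
      ∃ b : BlockCode (Fin k → A) (Fin k → A₁) (Fin k → B) (Fin k → B₁)
        ⌈(2 : ℝ) ^ ((k : ℝ) * R)⌉₊ S S,
        ∀ s, ∑ w, b.err (m.pow k).W s w ≤ ⌈(2 : ℝ) ^ ((k : ℝ) * R)⌉₊ * ε := by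
  obtain ⟨δ, hδ, hδ1, hδ2⟩ : ∃ δ : ℝ, 0 < δ ∧ R - m.messageRate + δ < 0 ∧
      R + m.compRate - m.stateRate - m.jointRate + 5 * δ < 0 := by
    refine ⟨min (m.messageRate - R) (m.jointRate + m.stateRate - R - m.compRate) / 6, ?_, ?_, ?_⟩
    · have : 0 < min (m.messageRate - R) (m.jointRate + m.stateRate - R - m.compRate) :=
        lt_min (by linarith) (by linarith)
      positivity
    · have := min_le_left (m.messageRate - R) (m.jointRate + m.stateRate - R - m.compRate)
      linarith
    · have := min_le_right (m.messageRate - R) (m.jointRate + m.stateRate - R - m.compRate)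
      linarith
  set I₀ := m.stateRate with hI₀
  set I₁ := m.compRate with hI₁
  set IA := m.messageRate with hIA
  set IB := m.jointRate with hIB
  have hpos : ∀ z, 0 < m.joint z → 0 < m.outLaw z.2.1 z.2.2.1 ∧ 0 < m.outMarginal z.2.2.1 ∧
      0 < m.compLaw z.2.1 z.2.2.2.2 ∧ 0 < m.pairGivenInputs z.1 z.2.1 z.2.2.1 z.2.2.2.2 ∧
      0 < m.pairLaw z.2.1 z.2.2.1 z.2.2.2.2 ∧ 0 < m.V z.2.1 z.2.2.2.1 z.2.2.2.2 := by
    intro z hz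
    obtain ⟨-, ho, hm, hc, hq, hl⟩ := m.marginals_pos hz
    exact ⟨ho, hm, hc, hq, hl, (m.pos_of_joint_pos hz).2.2.2⟩
  set U : (k : ℕ) → (Fin k → A₁) → (Fin k → B) → Prop := fun k x₁ y =>
    2 ^ ((k : ℝ) * (I₀ - δ)) * (m.pow k).outMarginal y < (m.pow k).outLaw x₁ y
  set TA : (k : ℕ) → (Fin k → A) → (Fin k → A₁) → (Fin k → B) → (Fin k → C) → Prop :=
    fun k x x₁ y c => 2 ^ ((k : ℝ) * (IA - δ)) * (m.pow k).pairLaw x₁ y c <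
      (m.pow k).pairGivenInputs x x₁ y c
  set TB : (k : ℕ) → (Fin k → A) → (Fin k → A₁) → (Fin k → B) → (Fin k → C) → Prop :=
    fun k x x₁ y c => 2 ^ ((k : ℝ) * (IB - δ)) * ((m.pow k).outLaw x₁ y * (m.pow k).compLaw x₁ c) <
      (m.pow k).pairGivenInputs x x₁ y c
  -- the four large deviation events
  have lim0 : Tendsto (fun k => (m.pow k).expect fun _ x₁ y _ _ => ind (¬U k x₁ y)) atTop (𝓝 0) := by
    refine m.tendsto_expect_pow (a := fun _ x₁ y _ _ => m.outLaw x₁ y)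
      (b := fun _ _ y _ _ => m.outMarginal y) hδ hI₀ (fun z hz => (hpos z hz).1)
      (fun z hz => (hpos z hz).2.1) ?_
    intro k _ x₁ y _ _ h
    rw [← m.pow_outLaw, ← m.pow_outMarginal]
    exact not_lt.mp h
  have limA : Tendsto (fun k => (m.pow k).expect fun x x₁ y _ c => ind (¬TA k x x₁ y c)) atTop
      (𝓝 0) := by
    refine m.tendsto_expect_pow (a := fun x x₁ y _ c => m.pairGivenInputs x x₁ y c)
      (b := fun _ x₁ y _ c => m.pairLaw x₁ y c) hδ hIA (fun z hz => (hpos z hz).2.2.2.1)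
      (fun z hz => (hpos z hz).2.2.2.2.1) ?_
    intro k x x₁ y _ c h
    rw [← m.pow_pairGivenInputs, ← m.pow_pairLaw]
    exact not_lt.mp h
  have limB : Tendsto (fun k => (m.pow k).expect fun x x₁ y _ c => ind (¬TB k x x₁ y c)) atTop
      (𝓝 0) := by
    refine m.tendsto_expect_pow (a := fun x x₁ y _ c => m.pairGivenInputs x x₁ y c)
      (b := fun _ x₁ y _ c => m.outLaw x₁ y * m.compLaw x₁ c) hδ hIB
      (fun z hz => (hpos z hz).2.2.2.1)
      (fun z hz => mul_pos (hpos z hz).1 (hpos z hz).2.2.1) ?_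
    intro k x x₁ y _ c h
    rw [← m.pow_pairGivenInputs, Finset.prod_mul_distrib, ← m.pow_outLaw, ← m.pow_compLaw]
    exact not_lt.mp h
  have limV : Tendsto (fun k => (m.pow k).expect fun _ x₁ _ y₁ c =>
      ind (2 ^ ((k : ℝ) * (I₁ + δ)) * (m.pow k).compLaw x₁ c < (m.pow k).V x₁ y₁ c)) atTop
      (𝓝 0) := by
    refine m.tendsto_expect_pow (a := fun _ x₁ _ _ c => m.compLaw x₁ c)
      (b := fun _ x₁ _ y₁ c => m.V x₁ y₁ c) (I := -I₁) hδ ?_ (fun z hz => (hpos z hz).2.2.1)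
      (fun z hz => (hpos z hz).2.2.2.2.2) ?_
    · rw [hI₁, compRate, expect, expect, ← Finset.sum_neg_distrib]
      refine Finset.sum_congr rfl fun z _ => ?_
      rw [← inv_div, Real.logb_inv, mul_neg, neg_neg]
    intro k x x₁ y y₁ c h
    rw [← m.pow_compLaw]
    have h3 : (0 : ℝ) < 2 ^ ((k : ℝ) * (I₁ + δ)) := by positivity
    have h4 : (2 : ℝ) ^ ((k : ℝ) * (-I₁ - δ)) = (2 ^ ((k : ℝ) * (I₁ + δ)))⁻¹ := by
      rw [← Real.rpow_neg (by norm_num)]; congr 1; ring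
    rw [h4, inv_mul_eq_div, le_div_iff₀ h3, mul_comm]
    exact h.le
  have limT : Tendsto (fun k => (m.pow k).expect fun x x₁ y _ c =>
      ind (¬(TA k x x₁ y c ∧ TB k x x₁ y c))) atTop (𝓝 0) := by
    have h3 := limA.add limB
    rw [add_zero] at h3
    refine squeeze_zero (fun k => Finset.sum_nonneg fun z _ =>
      mul_nonneg ((m.pow k).joint_nonneg z) (ind_nonneg _)) (fun k => ?_) h3
    unfold expect
    rw [← Finset.sum_add_distrib]
    refine Finset.sum_le_sum fun z _ => ?_
    rw [← mul_add]
    refine mul_le_mul_of_nonneg_left ?_ ((m.pow k).joint_nonneg z)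
    exact (ind_mono not_and_or.mp).trans (ind_or_le _ _)
  have limE : Tendsto (fun k : ℕ => Real.exp (-(2 : ℝ) ^ ((k : ℝ) * δ))) atTop (𝓝 0) :=
    Real.tendsto_exp_neg_atTop_nhds_zero.comp (tendsto_two_rpow_mul_atTop hδ)
  have limtot := ((((lim0.add (limT.div_const (ε / 8))).add limV).add limE).add
    (tendsto_two_rpow_mul (c := -δ) (by linarith))).add
    ((tendsto_two_rpow_mul hδ1).add ((tendsto_two_rpow_mul hδ2).const_mul 4))
  simp only [zero_div, mul_zero, add_zero] at limtot
  filter_upwards [limtot.eventually (gt_mem_nhds (show 0 < ε / 8 by positivity))] with k hk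
  set M := ⌈(2 : ℝ) ^ ((k : ℝ) * R)⌉₊
  set S := ⌈(2 : ℝ) ^ ((k : ℝ) * (I₀ - 2 * δ))⌉₊
  set L := ⌈(2 : ℝ) ^ ((k : ℝ) * (I₁ + 2 * δ))⌉₊
  have hM : 0 < M := Nat.ceil_pos.mpr (by positivity)
  have hS : 0 < S := Nat.ceil_pos.mpr (by positivity)
  have hL : 0 < L := Nat.ceil_pos.mpr (by positivity)
  have hM1 : (M : ℝ) - 1 ≤ 2 ^ ((k : ℝ) * R) := by
    have := Nat.ceil_lt_add_one (show (0 : ℝ) ≤ 2 ^ ((k : ℝ) * R) by positivity)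
    linarith
  have hS1 : (S : ℝ) - 1 ≤ 2 ^ ((k : ℝ) * (I₀ - 2 * δ)) := by
    have := Nat.ceil_lt_add_one (show (0 : ℝ) ≤ 2 ^ ((k : ℝ) * (I₀ - 2 * δ)) by positivity)
    linarith
  have hL1 : (L : ℝ) ≤ 2 * 2 ^ ((k : ℝ) * (I₁ + 2 * δ)) := by
    have := Nat.ceil_lt_add_one (show (0 : ℝ) ≤ 2 ^ ((k : ℝ) * (I₁ + 2 * δ)) by positivity)
    have : (1 : ℝ) ≤ 2 ^ ((k : ℝ) * (I₁ + 2 * δ)) :=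
      Real.one_le_rpow (by norm_num) (by positivity)
    linarith
  have hS' : (2 : ℝ) ^ ((k : ℝ) * (I₀ - 2 * δ)) / 2 ≤ ((S / 2 + 1 : ℕ) : ℝ) := by
    have h3 : (2 : ℝ) ^ ((k : ℝ) * (I₀ - 2 * δ)) ≤ S := Nat.le_ceil _
    have h4 : (S : ℝ) ≤ 2 * ((S / 2 + 1 : ℕ) : ℝ) := by
      have : S ≤ 2 * (S / 2 + 1) := by omega
      exact_mod_cast this
    linarith
  have hinv : ∀ r : ℝ, ((2 : ℝ) ^ ((k : ℝ) * r))⁻¹ = 2 ^ ((k : ℝ) * (-r)) := by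
    intro r; rw [← Real.rpow_neg (by norm_num)]; congr 1; ring
  have hmul : ∀ r r' : ℝ, (2 : ℝ) ^ ((k : ℝ) * r) * 2 ^ ((k : ℝ) * r') =
      2 ^ ((k : ℝ) * (r + r')) := by
    intro r r'; rw [← Real.rpow_add (by norm_num)]; congr 1; ring
  -- the exponents of the union bounds
  have bS : ((S : ℝ) - 1) * ((2 : ℝ) ^ ((k : ℝ) * (I₀ - δ)))⁻¹ ≤ 2 ^ ((k : ℝ) * (-δ)) := by
    calc _ ≤ (2 : ℝ) ^ ((k : ℝ) * (I₀ - 2 * δ)) * ((2 : ℝ) ^ ((k : ℝ) * (I₀ - δ)))⁻¹ :=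
          mul_le_mul_of_nonneg_right hS1 (by positivity)
      _ = _ := by rw [hinv, hmul]; congr 2; ring
  have bM : ((M : ℝ) - 1) * (((2 : ℝ) ^ ((k : ℝ) * (IA - δ)))⁻¹ + L / ((S / 2 + 1 : ℕ) : ℝ) *
      ((2 : ℝ) ^ ((k : ℝ) * (IB - δ)))⁻¹) ≤ 2 ^ ((k : ℝ) * (R - IA + δ)) +
      4 * 2 ^ ((k : ℝ) * (R + I₁ - I₀ - IB + 5 * δ)) := by
    have h3 : (L : ℝ) / ((S / 2 + 1 : ℕ) : ℝ) ≤
        4 * 2 ^ ((k : ℝ) * (I₁ - I₀ + 4 * δ)) := by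
      calc _ ≤ (2 * 2 ^ ((k : ℝ) * (I₁ + 2 * δ))) /
            ((2 : ℝ) ^ ((k : ℝ) * (I₀ - 2 * δ)) / 2) :=
            div_le_div₀ (by positivity) hL1 (by positivity) hS'
        _ = 4 * ((2 : ℝ) ^ ((k : ℝ) * (I₁ + 2 * δ)) *
            ((2 : ℝ) ^ ((k : ℝ) * (I₀ - 2 * δ)))⁻¹) := by field_simp; norm_num
        _ = _ := by rw [hinv, hmul]; congr 3; ring
    calc _ ≤ (2 : ℝ) ^ ((k : ℝ) * R) * (((2 : ℝ) ^ ((k : ℝ) * (IA - δ)))⁻¹ +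
          4 * 2 ^ ((k : ℝ) * (I₁ - I₀ + 4 * δ)) * ((2 : ℝ) ^ ((k : ℝ) * (IB - δ)))⁻¹) := by
          gcongr
      _ = (2 : ℝ) ^ ((k : ℝ) * R) * 2 ^ ((k : ℝ) * (-(IA - δ))) +
          4 * (2 ^ ((k : ℝ) * R) * (2 ^ ((k : ℝ) * (I₁ - I₀ + 4 * δ)) *
            2 ^ ((k : ℝ) * (-(IB - δ))))) := by rw [hinv, hinv]; ring
      _ = _ := by
          rw [hmul, hmul, hmul, show R + -(IA - δ) = R - IA + δ by ring,
            show R + (I₁ - I₀ + 4 * δ + -(IB - δ)) = R + I₁ - I₀ - IB + 5 * δ by ring]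
  have bE : Real.exp (-(L / (2 : ℝ) ^ ((k : ℝ) * (I₁ + δ)))) ≤
      Real.exp (-(2 : ℝ) ^ ((k : ℝ) * δ)) := by
    refine Real.exp_le_exp.mpr (neg_le_neg ?_)
    rw [le_div_iff₀ (by positivity), hmul]
    refine le_trans (le_of_eq ?_) (Nat.le_ceil _)
    congr 2; ring
  obtain ⟨b, hb⟩ := (m.pow k).exists_blockCode (S := S) (S' := S / 2 + 1) (L := L) hM hS
    (Nat.succ_pos _) hL le_rfl (U := U k) (T := fun x x₁ y c => TA k x x₁ y c ∧ TB k x x₁ y c)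
    (t := ε / 8) (γ := 2 ^ ((k : ℝ) * (I₁ + δ))) (κ := ((2 : ℝ) ^ ((k : ℝ) * (I₀ - δ)))⁻¹)
    (κA := ((2 : ℝ) ^ ((k : ℝ) * (IA - δ)))⁻¹) (κB := ((2 : ℝ) ^ ((k : ℝ) * (IB - δ)))⁻¹)
    (ε := ε / 2) (by positivity) (by positivity) (by positivity)
    ((m.pow k).state_test_le (by positivity))
    (fun x₁ y c => le_trans (Finset.sum_le_sum fun x _ => mul_le_mul_of_nonneg_left
      (ind_mono fun h => h.1) ((m.pow k).p_nonneg x))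
      ((m.pow k).message_test_le (by positivity) x₁ y c))
    (fun x₁ => le_trans (Finset.sum_le_sum fun x _ => mul_le_mul_of_nonneg_left
      (Finset.sum_le_sum fun y _ => mul_le_mul_of_nonneg_left (Finset.sum_le_sum fun c _ =>
        mul_le_mul_of_nonneg_left (ind_mono fun h => h.2) ((m.pow k).compLaw_nonneg _ _))
        ((m.pow k).outLaw_nonneg _ _)) ((m.pow k).p_nonneg x))
      ((m.pow k).independent_test_le (by positivity) x₁))
    (by linarith)
  refine ⟨S / 2 + 1, Nat.succ_pos _, b, fun s => (hb s).trans_eq ?_⟩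
  ring

end Model

/-! ### Concatenation of blocks -/

section Concatenation

variable {S Z O : Type*}

/-- A finite sequence continued by a constant. -/
def extend {K : ℕ} (o₀ : O) (u : Fin K → O) (i : ℕ) : O := if h : i < K then u ⟨i, h⟩ else o₀

lemma extend_of_lt {K : ℕ} (o₀ : O) (u : Fin K → O) {i : ℕ} (h : i < K) :
    extend o₀ u i = u ⟨i, h⟩ := dif_pos h

lemma extend_succ {K : ℕ} (o₀ : O) (u : Fin (K + 1) → O) (i : ℕ) :
    extend o₀ u (i + 1) = extend o₀ (fun b => u b.succ) i := by
  unfold extend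
  by_cases h : i < K
  · rw [dif_pos h, dif_pos (Nat.succ_lt_succ h)]; rfl
  · rw [dif_neg h, dif_neg (by omega)]

/-- The state of a machine with transition function `nx` after reading `b` symbols. -/
def stateAt (nx : S → O → S) (s₀ : S) (u : ℕ → O) : ℕ → S
  | 0 => s₀
  | b + 1 => nx (stateAt nx s₀ u b) (u b)

lemma stateAt_succ' (nx : S → O → S) (s₀ : S) (u : ℕ → O) (b : ℕ) :
    stateAt nx s₀ u (b + 1) = stateAt nx (nx s₀ (u 0)) (fun i => u (i + 1)) b := by
  induction b with
  | zero => rfl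
  | succ b ih => rw [stateAt, ih, stateAt]

lemma stateAt_congr (nx : S → O → S) (s₀ : S) {u v : ℕ → O} {b : ℕ} (h : ∀ i < b, u i = v i) :
    stateAt nx s₀ u b = stateAt nx s₀ v b := by
  induction b with
  | zero => rfl
  | succ b ih => rw [stateAt, stateAt, ih fun i hi => h i (by omega), h b (by omega)]

lemma sum_fin_succ_fun [Fintype Z] {K : ℕ} (F : (Fin (K + 1) → Z) → ℝ) :
    ∑ u, F u = ∑ z, ∑ u : Fin K → Z, F (Fin.cons z u) := by
  rw [← Equiv.sum_comp (Fin.consEquiv fun _ => Z), Fintype.sum_prod_type]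
  rfl

variable {wt : S → Z → ℝ} {c : ℝ} (nx : S → O → S) (π : Z → O) (o₀ : O)

lemma stateAt_cons {K : ℕ} (s₀ : S) (z : Z) (u : Fin K → Z) (b : Fin K) :
    stateAt nx s₀ (extend o₀ fun i => π ((Fin.cons z u : Fin (K + 1) → Z) i)) b.succ =
      stateAt nx (nx s₀ (π z)) (extend o₀ fun i => π (u i)) b := by
  rw [Fin.val_succ, stateAt_succ']
  congr 1
  funext i
  rw [extend_succ]
  simp only [Fin.cons_succ]

variable [Fintype Z]

lemma sum_path_weight (h1 : ∀ s, ∑ z, wt s z = c) (K : ℕ) (s₀ : S) :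
    ∑ u : Fin K → Z, ∏ b : Fin K,
      wt (stateAt nx s₀ (extend o₀ fun i => π (u i)) b) (u b) = c ^ K := by
  induction K generalizing s₀ with
  | zero => simp
  | succ K ih =>
    have hc : c ^ (K + 1) = ∑ z, wt s₀ z * c ^ K := by
      rw [← Finset.sum_mul, h1, pow_succ']
    rw [sum_fin_succ_fun, hc]
    refine Finset.sum_congr rfl fun z _ => ?_
    rw [← ih (nx s₀ (π z)), Finset.mul_sum]
    refine Finset.sum_congr rfl fun u _ => ?_
    rw [Fin.prod_univ_succ]
    congr 1
    refine Finset.prod_congr rfl fun b _ => ?_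
    rw [stateAt_cons, Fin.cons_succ]

/-- Union bound along the blocks: if a failure has small probability from every state, then a path
of `K` blocks has a failure with probability at most `K` times as large. -/
lemma sum_path_fail_le (h0 : ∀ s z, 0 ≤ wt s z) (h1 : ∀ s, ∑ z, wt s z = c) (hc : 0 ≤ c)
    {F : S → Z → Prop} {ε : ℝ} (hF : ∀ s, ∑ z, wt s z * ind (F s z) ≤ c * ε) (K : ℕ) (s₀ : S) :
    ∑ u : Fin K → Z, (∏ b : Fin K, wt (stateAt nx s₀ (extend o₀ fun i => π (u i)) b) (u b)) *
      ind (∃ b : Fin K, F (stateAt nx s₀ (extend o₀ fun i => π (u i)) b) (u b)) ≤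
    c ^ K * (K * ε) := by
  induction K generalizing s₀ with
  | zero =>
    simp [ind_false]
  | succ K ih =>
    rw [sum_fin_succ_fun]
    have h2 : ∀ z (u : Fin K → Z),
        (∏ b : Fin (K + 1), wt (stateAt nx s₀ (extend o₀ fun i =>
          π ((Fin.cons z u : Fin (K + 1) → Z) i)) b) ((Fin.cons z u : Fin (K + 1) → Z) b)) *
        ind (∃ b : Fin (K + 1), F (stateAt nx s₀ (extend o₀ fun i =>
          π ((Fin.cons z u : Fin (K + 1) → Z) i)) b) ((Fin.cons z u : Fin (K + 1) → Z) b)) ≤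
        wt s₀ z * ind (F s₀ z) *
          ∏ b : Fin K, wt (stateAt nx (nx s₀ (π z)) (extend o₀ fun i => π (u i)) b) (u b) +
        wt s₀ z * ((∏ b : Fin K,
          wt (stateAt nx (nx s₀ (π z)) (extend o₀ fun i => π (u i)) b) (u b)) *
          ind (∃ b : Fin K, F (stateAt nx (nx s₀ (π z)) (extend o₀ fun i => π (u i)) b) (u b))) := by
      intro z u
      rw [Fin.prod_univ_succ, Fin.exists_fin_succ]
      simp only [stateAt_cons, Fin.cons_succ, Fin.cons_zero, Fin.val_zero, stateAt]
      set P := ∏ b : Fin K, wt (stateAt nx (nx s₀ (π z)) (extend o₀ fun i => π (u i)) b) (u b)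
      have hP : 0 ≤ P := Finset.prod_nonneg fun _ _ => h0 _ _
      have h3 := mul_le_mul_of_nonneg_left (ind_or_le (F s₀ z)
        (∃ b : Fin K, F (stateAt nx (nx s₀ (π z)) (extend o₀ fun i => π (u i)) b) (u b)))
        (mul_nonneg (h0 s₀ z) hP)
      linarith
    refine (Finset.sum_le_sum fun z _ => Finset.sum_le_sum fun u _ => h2 z u).trans ?_
    simp only [Finset.sum_add_distrib, ← Finset.mul_sum]
    have h3 : ∑ z, wt s₀ z * ind (F s₀ z) * ∑ u : Fin K → Z, ∏ b : Fin K,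
        wt (stateAt nx (nx s₀ (π z)) (extend o₀ fun i => π (u i)) b) (u b) ≤ c * ε * c ^ K := by
      simp only [sum_path_weight nx π o₀ h1, ← Finset.sum_mul]
      exact mul_le_mul_of_nonneg_right (hF s₀) (pow_nonneg hc _)
    have h4 : ∑ z, wt s₀ z * ∑ u : Fin K → Z, (∏ b : Fin K,
        wt (stateAt nx (nx s₀ (π z)) (extend o₀ fun i => π (u i)) b) (u b)) *
        ind (∃ b : Fin K, F (stateAt nx (nx s₀ (π z)) (extend o₀ fun i => π (u i)) b) (u b)) ≤
        c * (c ^ K * (K * ε)) := by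
      refine (Finset.sum_le_sum fun z _ => mul_le_mul_of_nonneg_left (ih (nx s₀ (π z)))
        (h0 s₀ z)).trans_eq ?_
      rw [← Finset.sum_mul, h1]
    refine (add_le_add h3 h4).trans_eq ?_
    push_cast
    ring

end Concatenation

section BlockPath

variable {A A₁ B B₁ : Type*} [Fintype B] [Fintype B₁] {M S K : ℕ}

/-- The state in block `b` when the relay observes the blocks `v`. -/
def BlockCode.state (bc : BlockCode A A₁ B B₁ M S S) (s₀ : Fin S) (o₀ : B₁) (v : Fin K → B₁)
    (b : ℕ) : Fin S :=
  stateAt bc.next s₀ (extend o₀ v) b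

/-- The probability that some of `K` consecutive blocks fails when the messages `w` are sent. -/
def BlockCode.pathErr (bc : BlockCode A A₁ B B₁ M S S) (W : A → A₁ → B → B₁ → ℝ) (s₀ : Fin S)
    (o₀ : B₁) (w : Fin K → Fin M) : ℝ :=
  ∑ y : Fin K → B, ∑ v : Fin K → B₁,
    (∏ b : Fin K, W (bc.enc (w b)) (bc.relay (bc.state s₀ o₀ v b)) (y b) (v b)) *
      ind (∃ b : Fin K, bc.Fails (bc.state s₀ o₀ v b) (w b) (y b) (v b))

lemma BlockCode.sum_pathErr_le (bc : BlockCode A A₁ B B₁ M S S) {W : A → A₁ → B → B₁ → ℝ}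
    (hW0 : ∀ x x₁ y y₁, 0 ≤ W x x₁ y y₁) (hW1 : ∀ x x₁, ∑ y, ∑ y₁, W x x₁ y y₁ = 1) {ε : ℝ}
    (hε : ∀ s, ∑ w, bc.err W s w ≤ M * ε) (s₀ : Fin S) (o₀ : B₁) :
    ∑ w : Fin K → Fin M, bc.pathErr W s₀ o₀ w ≤ (M : ℝ) ^ K * (K * ε) := by
  have h := sum_path_fail_le (Z := Fin M × B × B₁) (c := (M : ℝ))
    (wt := fun s z => W (bc.enc z.1) (bc.relay s) z.2.1 z.2.2) bc.next (fun z => z.2.2) o₀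
    (fun s z => hW0 _ _ _ _)
    (fun s => by simp [Fintype.sum_prod_type, hW1]) (Nat.cast_nonneg M)
    (F := fun s z => bc.Fails s z.1 z.2.1 z.2.2) (ε := ε)
    (fun s => by simpa [Fintype.sum_prod_type, BlockCode.err] using hε s) K s₀
  refine le_trans (le_of_eq ?_) h
  let e : (Fin K → Fin M × B × B₁) ≃ (Fin K → Fin M) × (Fin K → B) × (Fin K → B₁) :=
    { toFun := fun z => (fun i => (z i).1, fun i => (z i).2.1, fun i => (z i).2.2)
      invFun := fun u i => (u.1 i, u.2.1 i, u.2.2 i)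
      left_inv := fun _ => rfl
      right_inv := fun _ => rfl }
  rw [← Equiv.sum_comp e.symm]
  simp only [Fintype.sum_prod_type]
  rfl

end BlockPath

section Flatten

variable {X X₁ Y Y₁ : Type*} {M S N B k : ℕ}

/-- The code of block length `(B + 1) k` that uses a block code `B + 1` times. The symbols of
block `b` are those numbered `k b, …, k b + k - 1`. `φ` lists the vectors of `B + 1` block
messages; the destination, which learns the last state of each pair from the following block,
determines all but the last component. -/
def BlockCode.toCode [Nonempty (Fin N)]
    (bc : BlockCode (Fin k → X) (Fin k → X₁) (Fin k → Y) (Fin k → Y₁) M S S) (s₀ : Fin S)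
    (o₀ : Y₁) (φ : Fin N → Fin (B + 1) → Fin M) : Code X X₁ Y Y₁ N ((B + 1) * k) where
  enc i t := bc.enc (φ i (finProdFinEquiv.symm t).1) (finProdFinEquiv.symm t).2
  relay t h := bc.relay (stateAt bc.next s₀ (fun b j => extend o₀ h (j + k * b))
    (finProdFinEquiv.symm t).1) (finProdFinEquiv.symm t).2
  dec y := Function.invFun (fun i (b : Fin B) => φ i b.castSucc) fun b =>
    bc.decMsg (bc.decState fun j => y (finProdFinEquiv (b.castSucc, j)))
      (bc.decState fun j => y (finProdFinEquiv (b.succ, j)))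
      fun j => y (finProdFinEquiv (b.castSucc, j))

/-- A sequence of `K k` symbols as a sequence of `K` blocks. -/
def blocksEquiv (K k : ℕ) (Y : Type*) : (Fin (K * k) → Y) ≃ (Fin K → Fin k → Y) where
  toFun y b j := y (finProdFinEquiv (b, j))
  invFun u t := u (finProdFinEquiv.symm t).1 (finProdFinEquiv.symm t).2
  left_inv y := by funext t; exact congrArg y (finProdFinEquiv.apply_symm_apply t)
  right_inv u := by funext b j; simp

lemma BlockCode.toCode_relayInput [Nonempty (Fin N)]
    (bc : BlockCode (Fin k → X) (Fin k → X₁) (Fin k → Y) (Fin k → Y₁) M S S) (s₀ : Fin S)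
    (o₀ : Y₁) (φ : Fin N → Fin (B + 1) → Fin M) (y₁ : Fin ((B + 1) * k) → Y₁) (b : Fin (B + 1))
    (j : Fin k) : (bc.toCode s₀ o₀ φ).relayInput y₁ (finProdFinEquiv (b, j)) =
      bc.relay (bc.state s₀ (fun _ => o₀) (blocksEquiv _ _ _ y₁) b) j := by
  unfold Code.relayInput BlockCode.toCode BlockCode.state
  simp only [Equiv.symm_apply_apply]
  refine congrArg (fun s => bc.relay s j) (stateAt_congr _ _ fun i hi => ?_)
  funext j'
  have hiB : i < B + 1 := hi.trans b.isLt
  have hlt : (j' : ℕ) + k * i < (finProdFinEquiv (b, j) : Fin ((B + 1) * k)) := by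
    rw [finProdFinEquiv_apply_val]
    have : k * (i + 1) ≤ k * b := Nat.mul_le_mul_left k hi
    have := j'.isLt
    simp only
    linarith [mul_add k i 1]
  rw [extend_of_lt _ _ hlt, extend_of_lt _ _ hiB]
  rfl

variable [Fintype Y] [Fintype Y₁]

/-- An error of the concatenated code requires a failure in some block. -/
lemma BlockCode.errorProb_toCode_le [Nonempty (Fin N)]
    (bc : BlockCode (Fin k → X) (Fin k → X₁) (Fin k → Y) (Fin k → Y₁) M S S) (s₀ : Fin S)
    (o₀ : Y₁) (φ : Fin N → Fin (B + 1) → Fin M)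
    (hφ : Function.Injective fun i (b : Fin B) => φ i b.castSucc) (W : X → X₁ → PMF (Y × Y₁)) :
    (bc.toCode s₀ o₀ φ).errorProb W ≤ (1 / (N : ℝ)) * ∑ i, bc.pathErr
      (fun x x₁ y y₁ => ∏ j, (W (x j) (x₁ j) (y j, y₁ j)).toReal) s₀ (fun _ => o₀) (φ i) := by
  unfold Code.errorProb
  refine mul_le_mul_of_nonneg_left (Finset.sum_le_sum fun i _ => ?_) (by positivity)
  unfold BlockCode.pathErr
  rw [← Equiv.sum_comp (blocksEquiv (B + 1) k Y)]
  refine Finset.sum_le_sum fun y _ => ?_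
  rw [← Equiv.sum_comp (blocksEquiv (B + 1) k Y₁)]
  refine Finset.sum_le_sum fun y₁ _ => ?_
  set u := blocksEquiv (B + 1) k Y y
  set v := blocksEquiv (B + 1) k Y₁ y₁
  set st := bc.state s₀ (fun _ => o₀) v
  have hprod : (bc.toCode s₀ o₀ φ).outputProb W i y y₁ =
      ∏ b, ∏ j, (W (bc.enc (φ i b) j) (bc.relay (st b) j) (u b j, v b j)).toReal := by
    unfold Code.outputProb
    rw [← Equiv.prod_comp finProdFinEquiv, Fintype.prod_prod_type]
    refine Finset.prod_congr rfl fun b _ => Finset.prod_congr rfl fun j _ => ?_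
    rw [bc.toCode_relayInput]
    simp only [BlockCode.toCode, Equiv.symm_apply_apply]
    rfl
  rw [hprod]
  set P := ∏ b, ∏ j, (W (bc.enc (φ i b) j) (bc.relay (st b) j) (u b j, v b j)).toReal
  have hP : 0 ≤ P := Finset.prod_nonneg fun _ _ => Finset.prod_nonneg fun _ _ =>
    ENNReal.toReal_nonneg
  by_cases hF : ∃ b : Fin (B + 1), bc.Fails (st b) (φ i b) (u b) (v b)
  · rw [ind_true hF, mul_one]
    split_ifs <;> simp [hP]
  · rw [ind_false hF, mul_zero]
    refine le_of_eq (if_neg ?_)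
    rw [not_not]
    push Not at hF
    have h1 : ∀ b : Fin (B + 1), bc.decState (u b) = st b := fun b => by
      by_contra h; exact hF b (Or.inl h)
    have h2 : ∀ b : Fin (B + 1), bc.decMsg (st b) (bc.next (st b) (v b)) (u b) = φ i b :=
      fun b => by by_contra h; exact hF b (Or.inr h)
    have h3 : (fun b : Fin B => bc.decMsg (bc.decState (u b.castSucc)) (bc.decState (u b.succ))
        (u b.castSucc)) = fun b : Fin B => φ i b.castSucc := by
      funext b
      rw [h1, h1, ← h2 b.castSucc]
      congr 1
      simp only [st, BlockCode.state, Fin.val_succ, Fin.val_castSucc, stateAt]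
      rw [extend_of_lt _ _ (by omega : (b : ℕ) < B + 1)]
      rfl
    change Function.invFun (fun i (b : Fin B) => φ i b.castSucc) (fun b : Fin B =>
      bc.decMsg (bc.decState (u b.castSucc)) (bc.decState (u b.succ)) (u b.castSucc)) = i
    rw [h3]
    exact Function.leftInverse_invFun hφ i

end Flatten

/-! ### Achievability from good block codes -/

section Achievability

lemma sum_pmf_toReal {α : Type*} [Fintype α] (p : PMF α) : ∑ a, (p a).toReal = 1 := by
  rw [← ENNReal.toReal_sum fun a _ => p.apply_ne_top a, ← tsum_fintype (L := .unconditional _), p.tsum_coe,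
    ENNReal.toReal_one]

variable {X X₁ Y Y₁ : Type*} {M n : ℕ}

/-- A code followed by one fixed symbol, whose outputs the destination ignores. -/
def Code.pad (c : Code X X₁ Y Y₁ M n) (x : X) (x₁ : X₁) : Code X X₁ Y Y₁ M (n + 1) where
  enc w i := if h : (i : ℕ) < n then c.enc w ⟨i, h⟩ else x
  relay i h := if hi : (i : ℕ) < n then c.relay ⟨i, hi⟩ h else x₁
  dec y := c.dec fun i => y i.castSucc

variable [Fintype Y] [Fintype Y₁]

lemma sum_fin_snoc {Z : Type*} [Fintype Z] {K : ℕ} (F : (Fin (K + 1) → Z) → ℝ) :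
    ∑ u, F u = ∑ u : Fin K → Z, ∑ z, F (Fin.snoc (α := fun _ => Z) u z) := by
  rw [← Equiv.sum_comp (Fin.snocEquiv fun _ => Z), Fintype.sum_prod_type, Finset.sum_comm]
  rfl

lemma Code.errorProb_pad (W : X → X₁ → PMF (Y × Y₁)) (c : Code X X₁ Y Y₁ M n) (x : X) (x₁ : X₁) :
    (c.pad x x₁).errorProb W = c.errorProb W := by
  unfold Code.errorProb
  congr 1
  refine Finset.sum_congr rfl fun w _ => ?_
  rw [sum_fin_snoc]
  refine Finset.sum_congr rfl fun y _ => ?_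
  have hout : ∀ (a : Y) (y₁ : Fin n → Y₁) (a₁ : Y₁), (c.pad x x₁).outputProb W w
      (Fin.snoc (α := fun _ => Y) y a) (Fin.snoc (α := fun _ => Y₁) y₁ a₁) =
      c.outputProb W w y y₁ * (W x x₁ (a, a₁)).toReal := by
    intro a y₁ a₁
    unfold Code.outputProb
    rw [Fin.prod_univ_castSucc]
    congr 1
    · refine Finset.prod_congr rfl fun i _ => ?_
      have h1 : (c.pad x x₁).relayInput (Fin.snoc (α := fun _ => Y₁) y₁ a₁) i.castSucc =
          c.relayInput y₁ i := by
        unfold Code.relayInput Code.pad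
        simp only [Fin.val_castSucc, i.isLt, dif_pos]
        congr 1
        funext j
        exact Fin.snoc_castSucc (α := fun _ => Y₁) a₁ y₁ ⟨j, j.isLt.trans i.isLt⟩
      have h2 : (c.pad x x₁).enc w i.castSucc = c.enc w i := by simp [Code.pad]
      rw [h1, h2, Fin.snoc_castSucc, Fin.snoc_castSucc]
    · have h1 : (c.pad x x₁).relayInput (Fin.snoc (α := fun _ => Y₁) y₁ a₁) (Fin.last n) = x₁ := by
        simp [Code.relayInput, Code.pad]
      have h2 : (c.pad x x₁).enc w (Fin.last n) = x := by simp [Code.pad]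
      rw [h1, h2, Fin.snoc_last, Fin.snoc_last]
  have hdec : ∀ a, (c.pad x x₁).dec (Fin.snoc (α := fun _ => Y) y a) = c.dec y := by
    intro a; simp [Code.pad]
  have hW : ∑ a, ∑ a₁, (W x x₁ (a, a₁)).toReal = 1 := by
    rw [← sum_pmf_toReal (W x x₁), Fintype.sum_prod_type]
  by_cases h : c.dec y ≠ w
  · simp only [hdec, if_pos h]
    simp only [sum_fin_snoc (Z := Y₁), hout]
    rw [Finset.sum_comm]
    refine Finset.sum_congr rfl fun y₁ _ => ?_
    simp only [← Finset.mul_sum, hW, mul_one]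
  · simp only [hdec, if_neg h, Finset.sum_const_zero]

lemma exists_code_of_le [Nonempty X] [Nonempty X₁] (W : X → X₁ → PMF (Y × Y₁))
    (c : Code X X₁ Y Y₁ M n) {n' : ℕ} (h : n ≤ n') :
    ∃ c' : Code X X₁ Y Y₁ M n', c'.errorProb W = c.errorProb W := by
  induction n', h using Nat.le_induction with
  | base => exact ⟨c, rfl⟩
  | succ n' _ ih =>
    obtain ⟨c', hc'⟩ := ih
    exact ⟨c'.pad (Classical.arbitrary X) (Classical.arbitrary X₁), by rw [Code.errorProb_pad, hc']⟩

lemma Code.errorProb_nonneg (W : X → X₁ → PMF (Y × Y₁)) (c : Code X X₁ Y Y₁ M n) :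
    0 ≤ c.errorProb W := by
  refine mul_nonneg (by positivity) (Finset.sum_nonneg fun w _ => Finset.sum_nonneg fun y _ =>
    Finset.sum_nonneg fun y₁ _ => ?_)
  split_ifs
  · exact Finset.prod_nonneg fun _ _ => ENNReal.toReal_nonneg
  · exact le_rfl

lemma achievable_of_eventually_exists [Nonempty X] [Nonempty X₁] {W : X → X₁ → PMF (Y × Y₁)}
    {R : ℝ} (h : ∀ ε : ℝ, 0 < ε → ∀ᶠ n : ℕ in atTop,
      ∃ c : Code X X₁ Y Y₁ ⌈(2 : ℝ) ^ ((n : ℝ) * R)⌉₊ n, c.errorProb W ≤ ε) :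
    Achievable W R := by
  have hbest : ∀ n : ℕ, ∃ c : Code X X₁ Y Y₁ ⌈(2 : ℝ) ^ ((n : ℝ) * R)⌉₊ n,
      ∀ c' : Code X X₁ Y Y₁ ⌈(2 : ℝ) ^ ((n : ℝ) * R)⌉₊ n,
        c.errorProb W ≤ c'.errorProb W + 1 / ((n : ℝ) + 1) := by
    intro n
    have hM : 0 < ⌈(2 : ℝ) ^ ((n : ℝ) * R)⌉₊ := Nat.ceil_pos.mpr (by positivity)
    have : Nonempty (Code X X₁ Y Y₁ ⌈(2 : ℝ) ^ ((n : ℝ) * R)⌉₊ n) :=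
      ⟨⟨fun _ _ => Classical.arbitrary X, fun _ _ => Classical.arbitrary X₁, fun _ => ⟨0, hM⟩⟩⟩
    have hbdd : BddBelow (Set.range fun c : Code X X₁ Y Y₁ ⌈(2 : ℝ) ^ ((n : ℝ) * R)⌉₊ n =>
        c.errorProb W) := ⟨0, by rintro _ ⟨c, rfl⟩; exact c.errorProb_nonneg W⟩
    obtain ⟨c, hc⟩ := exists_lt_of_ciInf_lt (lt_add_of_pos_right
      (⨅ c : Code X X₁ Y Y₁ ⌈(2 : ℝ) ^ ((n : ℝ) * R)⌉₊ n, c.errorProb W)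
      (show (0 : ℝ) < 1 / ((n : ℝ) + 1) by positivity))
    exact ⟨c, fun c' => hc.le.trans (by linarith [ciInf_le hbdd c'])⟩
  choose c hc using hbest
  refine ⟨c, ?_⟩
  rw [Metric.tendsto_atTop']
  intro ε hε
  have h1 : ∀ᶠ n : ℕ in atTop, 1 / ((n : ℝ) + 1) < ε / 2 :=
    tendsto_one_div_add_atTop_nhds_zero_nat.eventually (gt_mem_nhds (by positivity))
  obtain ⟨n₀, hn₀⟩ := eventually_atTop.mp ((h (ε / 2) (by positivity)).and h1)
  refine ⟨n₀, fun n hn => ?_⟩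
  obtain ⟨⟨c', hc'⟩, h2⟩ := hn₀ n hn.le
  rw [Real.dist_eq, sub_zero, abs_of_nonneg ((c n).errorProb_nonneg W)]
  linarith [hc n c']

/-- Rates that are not positive are achievable with a single message. -/
lemma achievable_of_nonpos [Nonempty X] [Nonempty X₁] {W : X → X₁ → PMF (Y × Y₁)} {R : ℝ}
    (hR : R ≤ 0) : Achievable W R := by
  refine achievable_of_eventually_exists fun ε hε => Eventually.of_forall fun n => ?_
  have hM : ⌈(2 : ℝ) ^ ((n : ℝ) * R)⌉₊ = 1 := by
    refine le_antisymm (Nat.ceil_le.mpr ?_) (Nat.ceil_pos.mpr (by positivity))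
    rw [Nat.cast_one]
    exact Real.rpow_le_one_of_one_le_of_nonpos (by norm_num)
      (mul_nonpos_of_nonneg_of_nonpos (Nat.cast_nonneg n) hR)
  rw [hM]
  refine ⟨⟨fun _ _ => Classical.arbitrary X, fun _ _ => Classical.arbitrary X₁, fun _ => 0⟩, ?_⟩
  refine le_trans (le_of_eq ?_) hε.le
  simp [Code.errorProb, Subsingleton.elim _ (0 : Fin 1)]

/-- A positive rate is achievable if it satisfies the two conditions for good block codes. The
number of blocks makes up for the loss of the last block, which carries no message. -/
theorem achievable_of_lt {C : Type*} [Fintype X] [Fintype X₁] [Fintype C]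
    {W : X → X₁ → PMF (Y × Y₁)} (m : Model X X₁ Y Y₁ C)
    (hW : ∀ x x₁ y y₁, m.W x x₁ y y₁ = (W x x₁ (y, y₁)).toReal) [Nonempty X] [Nonempty X₁]
    {R : ℝ} (hR : 0 ≤ R) (hc : 0 ≤ m.compRate) (h1 : R < m.messageRate)
    (h2 : R + m.compRate < m.jointRate + m.stateRate) : Achievable W R := by
  classical
  refine achievable_of_eventually_exists fun ε hε => ?_
  obtain ⟨R', hRR', hR'⟩ := exists_between
    (lt_min h1 (show R < m.jointRate + m.stateRate - m.compRate by linarith))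
  have h1' := hR'.trans_le (min_le_left _ _)
  have h2' := hR'.trans_le (min_le_right _ _)
  obtain ⟨B, hB⟩ := exists_nat_gt (R / (R' - R))
  rw [div_lt_iff₀ (by linarith)] at hB
  have hR'0 : 0 < R' := by linarith
  set ε' := ε / (2 * (B + 1)) with hε'
  have hε'0 : 0 < ε' := by positivity
  have hev1 := m.eventually_exists_blockCode (R := R') hc h1' (by linarith) hε'0
  have hev2 : ∀ᶠ k : ℕ in atTop, 1 + ((k : ℝ) + 1) * (B + 1) * R ≤ k * B * R' := by
    obtain ⟨k₀, hk₀⟩ := exists_nat_gt ((1 + (B + 1) * R) / (B * (R' - R) - R))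
    rw [div_lt_iff₀ (by linarith)] at hk₀
    filter_upwards [eventually_ge_atTop k₀] with k hk
    have : (k₀ : ℝ) * (B * (R' - R) - R) ≤ k * (B * (R' - R) - R) :=
      mul_le_mul_of_nonneg_right (by exact_mod_cast hk) (by linarith)
    linarith
  have hdiv : Tendsto (fun n : ℕ => n / (B + 1)) atTop atTop :=
    Nat.tendsto_div_const_atTop (Nat.succ_ne_zero B)
  filter_upwards [hdiv.eventually hev1, hdiv.eventually hev2] with n hn1 hn2
  set k := n / (B + 1) with hk
  set M := ⌈(2 : ℝ) ^ ((k : ℝ) * R')⌉₊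
  set N := ⌈(2 : ℝ) ^ ((n : ℝ) * R)⌉₊
  obtain ⟨S, hS, bc, hbc⟩ := hn1
  have hM : 0 < M := Nat.ceil_pos.mpr (by positivity)
  have hN : 0 < N := Nat.ceil_pos.mpr (by positivity)
  have hnk : (n : ℝ) ≤ ((k : ℝ) + 1) * (B + 1) := by
    have h3 : n < (B + 1) * (n / (B + 1) + 1) := Nat.lt_mul_div_succ n (Nat.succ_pos B)
    have h4 : (n : ℝ) < ((B : ℝ) + 1) * ((k : ℝ) + 1) := by exact_mod_cast h3
    linarith
  have hcard : N ≤ Fintype.card (Fin B → Fin M) / 2 + 1 := by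
    have h3 : ((N : ℝ) - 1) * 2 ≤ (M : ℝ) ^ B := by
      have h4 : (N : ℝ) - 1 ≤ 2 ^ ((n : ℝ) * R) := by
        have := Nat.ceil_lt_add_one (show (0 : ℝ) ≤ 2 ^ ((n : ℝ) * R) by positivity)
        linarith
      calc ((N : ℝ) - 1) * 2 ≤ 2 ^ ((n : ℝ) * R) * 2 := by linarith
        _ = 2 ^ (1 + (n : ℝ) * R) := by
            rw [Real.rpow_add (by norm_num), Real.rpow_one]; ring
        _ ≤ 2 ^ ((k : ℝ) * B * R') :=
            Real.rpow_le_rpow_of_exponent_le (by norm_num)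
              (le_trans (by nlinarith [mul_le_mul_of_nonneg_right hnk hR]) hn2)
        _ = ((2 : ℝ) ^ ((k : ℝ) * R')) ^ B := by
            rw [← Real.rpow_natCast, ← Real.rpow_mul (by norm_num)]; congr 1; ring
        _ ≤ (M : ℝ) ^ B := pow_le_pow_left₀ (by positivity) (Nat.le_ceil _) B
    have h5 : (N - 1) * 2 ≤ M ^ B := by
      have : ((N - 1 : ℕ) : ℝ) * 2 ≤ (M : ℝ) ^ B := by rwa [Nat.cast_sub hN, Nat.cast_one]
      exact_mod_cast this
    rw [Fintype.card_fun, Fintype.card_fin, Fintype.card_fin]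
    omega
  have : Nonempty (Fin M) := ⟨⟨0, hM⟩⟩
  have : Nonempty (Fin N) := ⟨⟨0, hN⟩⟩
  have o₀ : Y₁ := (W (Classical.arbitrary X) (Classical.arbitrary X₁)).support_nonempty.some.2
  have s₀ : Fin S := ⟨0, hS⟩
  let Wk := (m.pow k).W
  have hpath := bc.sum_pathErr_le (K := B + 1) (m.pow k).W_nonneg (m.pow k).sum_W hbc s₀
    (fun _ => o₀)
  -- the message of the last block is fixed
  obtain ⟨w₀, hw₀⟩ : ∃ w₀ : Fin M, ∑ w : Fin B → Fin M,
      bc.pathErr Wk s₀ (fun _ => o₀) (Fin.snoc (α := fun _ => Fin M) w w₀) ≤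
        (M : ℝ) ^ B * ((B + 1) * ε') := by
    rw [sum_fin_snoc, Finset.sum_comm] at hpath
    obtain ⟨w₀, _, h⟩ := Finset.exists_le_of_sum_le (s := (Finset.univ : Finset (Fin M)))
      (g := fun _ => (M : ℝ) ^ B * ((B + 1) * ε')) Finset.univ_nonempty (hpath.trans_eq (by
        simp only [Finset.sum_const, Finset.card_univ, Fintype.card_fin, nsmul_eq_mul]
        push_cast; ring))
    exact ⟨w₀, h⟩
  have hnn : ∀ w : Fin B → Fin M, 0 ≤ bc.pathErr Wk s₀ (fun _ => o₀) (Fin.snoc (α := fun _ => Fin M) w w₀) :=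
    fun w => Finset.sum_nonneg fun _ _ => Finset.sum_nonneg fun _ _ => mul_nonneg
      (Finset.prod_nonneg fun _ _ => (m.pow k).W_nonneg _ _ _ _) (ind_nonneg _)
  obtain ⟨f, hf⟩ := exists_embedding_le_two_mul (N := N) (ε := (B + 1) * ε') hnn (by positivity)
    (by simpa using hw₀) hcard
  have hinj : Function.Injective fun (i : Fin N) (b : Fin B) =>
      (Fin.snoc (α := fun _ => Fin M) (f i) w₀ : Fin (B + 1) → Fin M) b.castSucc := by
    intro i j hij
    simp only [Fin.snoc_castSucc] at hij
    exact f.injective hij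
  have herr := bc.errorProb_toCode_le s₀ o₀
    (fun i => (Fin.snoc (α := fun _ => Fin M) (f i) w₀ : Fin (B + 1) → Fin M)) hinj W
  obtain ⟨c', hc'⟩ := exists_code_of_le W (bc.toCode s₀ o₀
    (fun i => (Fin.snoc (α := fun _ => Fin M) (f i) w₀ : Fin (B + 1) → Fin M)))
    (Nat.mul_div_le n (B + 1))
  refine ⟨c', hc'.le.trans (herr.trans ?_)⟩
  have hWk : (fun (x : Fin k → X) (x₁ : Fin k → X₁) (y : Fin k → Y) (y₁ : Fin k → Y₁) =>
      ∏ j, (W (x j) (x₁ j) (y j, y₁ j)).toReal) = Wk := by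
    funext x x₁ y y₁
    simp only [Wk, Model.pow, hW]
  rw [hWk]
  have hεε : 2 * ((B + 1) * ε') = ε := by rw [hε']; field_simp
  have hN' : (0 : ℝ) < N := by exact_mod_cast hN
  calc _ ≤ 1 / (N : ℝ) * ∑ _i : Fin N, ε :=
        mul_le_mul_of_nonneg_left (Finset.sum_le_sum fun i _ => (hf i).trans_eq hεε)
          (by positivity)
    _ = ε := by simp; field_simp

end Achievability

/-! ### Entropies of the joint law -/

section Entropies

variable {X X₁ Y Y₁ Yh : Type*} [Fintype X] [Fintype X₁] [Fintype Y] [Fintype Y₁] [Fintype Yh]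

/-- The real-valued model of a relay channel and of a choice of laws. -/
def Model.ofPMF (W : X → X₁ → PMF (Y × Y₁)) (p : PMF X) (p₁ : PMF X₁) (V : X₁ → Y₁ → PMF Yh) :
    Model X X₁ Y Y₁ Yh where
  p x := (p x).toReal
  p₁ x₁ := (p₁ x₁).toReal
  W x x₁ y y₁ := (W x x₁ (y, y₁)).toReal
  V x₁ y₁ c := (V x₁ y₁ c).toReal
  p_nonneg _ := ENNReal.toReal_nonneg
  p₁_nonneg _ := ENNReal.toReal_nonneg
  W_nonneg _ _ _ _ := ENNReal.toReal_nonneg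
  V_nonneg _ _ _ := ENNReal.toReal_nonneg
  sum_p := sum_pmf_toReal p
  sum_p₁ := sum_pmf_toReal p₁
  sum_W x x₁ := by rw [← sum_pmf_toReal (W x x₁), Fintype.sum_prod_type]
  sum_V x₁ y₁ := sum_pmf_toReal (V x₁ y₁)

variable (W : X → X₁ → PMF (Y × Y₁)) (p : PMF X) (p₁ : PMF X₁) (V : X₁ → Y₁ → PMF Yh)
variable {T T' T'' : Type*}

lemma toReal_bind_apply {α β : Type*} [Fintype α] (q : PMF α) (f : α → PMF β) (b : β) :
    (q.bind f b).toReal = ∑ a, (q a).toReal * (f a b).toReal := by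
  rw [PMF.bind_apply, tsum_fintype, ENNReal.toReal_sum fun a _ =>
    ENNReal.mul_ne_top (q.apply_ne_top a) ((f a).apply_ne_top b)]
  simp only [ENNReal.toReal_mul]

lemma toReal_map_apply {α β : Type*} [Fintype α] (q : PMF α) (f : α → β) (b : β) :
    (q.map f b).toReal = ∑ a, (q a).toReal * ind (f a = b) := by
  rw [← PMF.bind_pure_comp, toReal_bind_apply]
  refine Finset.sum_congr rfl fun a _ => ?_
  congr 1
  by_cases h : f a = b
  · subst h; rw [ind_true rfl]; simp
  · rw [ind_false h]; simp [PMF.pure_apply, Ne.symm h]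

lemma prob_jointLaw (S : Outcome X X₁ Y Y₁ Yh → T) (a : T) :
    prob (jointLaw W p p₁ V) S a = (Model.ofPMF W p p₁ V).expect
      fun x x₁ y y₁ c => ind (S ⟨x, x₁, y, y₁, c⟩ = a) := by
  unfold prob jointLaw
  simp only [PMF.map_bind, PMF.map_comp, toReal_bind_apply, toReal_map_apply]
  rw [Model.expect_eq]
  simp only [Fintype.sum_prod_type, Model.ofPMF, Finset.mul_sum, Function.comp]
  rw [Finset.sum_comm]
  refine Finset.sum_congr rfl fun _ _ => Finset.sum_congr rfl fun _ _ =>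
    Finset.sum_congr rfl fun _ _ => Finset.sum_congr rfl fun _ _ =>
    Finset.sum_congr rfl fun _ _ => by ring

variable [Fintype T] [Fintype T'] [Fintype T'']

lemma sum_prob_mul (S : Outcome X X₁ Y Y₁ Yh → T) (f : T → ℝ) :
    ∑ a, prob (jointLaw W p p₁ V) S a * f a = (Model.ofPMF W p p₁ V).expect
      fun x x₁ y y₁ c => f (S ⟨x, x₁, y, y₁, c⟩) := by
  simp only [prob_jointLaw, Model.expect, Finset.sum_mul]
  rw [Finset.sum_comm]
  refine Finset.sum_congr rfl fun z _ => ?_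
  rw [Finset.sum_eq_single (S ⟨z.1, z.2.1, z.2.2.1, z.2.2.2.1, z.2.2.2.2⟩)]
  · rw [ind_true rfl, mul_one]
  · intro b _ hb; rw [ind_false hb.symm, mul_zero, zero_mul]
  · simp

lemma entropy_jointLaw (S : Outcome X X₁ Y Y₁ Yh → T) :
    entropy (jointLaw W p p₁ V) S = -(Model.ofPMF W p p₁ V).expect fun x x₁ y y₁ c =>
      Real.logb 2 (prob (jointLaw W p p₁ V) S (S ⟨x, x₁, y, y₁, c⟩)) := by
  unfold entropy
  rw [sum_prob_mul]

lemma condEntropy_jointLaw (S : Outcome X X₁ Y Y₁ Yh → T) (U : Outcome X X₁ Y Y₁ Yh → T') :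
    condEntropy (jointLaw W p p₁ V) S U = -(Model.ofPMF W p p₁ V).expect fun x x₁ y y₁ c =>
      Real.logb 2 (prob (jointLaw W p p₁ V) (fun ω => (S ω, U ω))
        (S ⟨x, x₁, y, y₁, c⟩, U ⟨x, x₁, y, y₁, c⟩) /
          prob (jointLaw W p p₁ V) U (U ⟨x, x₁, y, y₁, c⟩)) := by
  unfold condEntropy
  rw [← Fintype.sum_prod_type' (f := fun a b => prob (jointLaw W p p₁ V) (fun ω => (S ω, U ω))
    (a, b) * Real.logb 2 (prob (jointLaw W p p₁ V) (fun ω => (S ω, U ω)) (a, b) /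
      prob (jointLaw W p p₁ V) U b))]
  rw [sum_prob_mul W p p₁ V (fun ω => (S ω, U ω)) fun ab =>
    Real.logb 2 (prob (jointLaw W p p₁ V) (fun ω => (S ω, U ω)) (ab.1, ab.2) /
      prob (jointLaw W p p₁ V) U ab.2)]

lemma condMutualInfo_jointLaw (S : Outcome X X₁ Y Y₁ Yh → T) (U : Outcome X X₁ Y Y₁ Yh → T')
    (Q : Outcome X X₁ Y Y₁ Yh → T'') :
    condMutualInfo (jointLaw W p p₁ V) S U Q = (Model.ofPMF W p p₁ V).expect fun x x₁ y y₁ c =>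
      Real.logb 2 (prob (jointLaw W p p₁ V) (fun ω => (S ω, U ω, Q ω))
        (S ⟨x, x₁, y, y₁, c⟩, U ⟨x, x₁, y, y₁, c⟩, Q ⟨x, x₁, y, y₁, c⟩) /
          prob (jointLaw W p p₁ V) (fun ω => (U ω, Q ω))
            (U ⟨x, x₁, y, y₁, c⟩, Q ⟨x, x₁, y, y₁, c⟩)) -
      Real.logb 2 (prob (jointLaw W p p₁ V) (fun ω => (S ω, Q ω))
        (S ⟨x, x₁, y, y₁, c⟩, Q ⟨x, x₁, y, y₁, c⟩) /
          prob (jointLaw W p p₁ V) Q (Q ⟨x, x₁, y, y₁, c⟩)) := by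
  unfold condMutualInfo
  rw [condEntropy_jointLaw, condEntropy_jointLaw, Model.expect_sub]
  ring

/-! ### Marginals of the joint law -/

section Marginals

variable (x : X) (x₁ : X₁) (y : Y) (y₁ : Y₁) (c : Yh)

lemma prob_state : prob (jointLaw W p p₁ V) Outcome.x₁ x₁ = (Model.ofPMF W p p₁ V).p₁ x₁ := by
  classical
  rw [prob_jointLaw, Model.expect_eq]
  simp [ind, Finset.sum_ite_irrel, Model.sum_V, Model.sum_W, Model.sum_p]

lemma prob_source_state : prob (jointLaw W p p₁ V) (fun ω => (ω.x, ω.x₁)) (x, x₁) = (Model.ofPMF W p p₁ V).p x * (Model.ofPMF W p p₁ V).p₁ x₁ := by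
  classical
  rw [prob_jointLaw, Model.expect_eq]
  simp [ind, ite_and, Finset.sum_ite_irrel, Model.sum_V, Model.sum_W, mul_comm]

lemma prob_out : prob (jointLaw W p p₁ V) Outcome.y y = (Model.ofPMF W p p₁ V).outMarginal y := by
  classical
  rw [prob_jointLaw, Model.expect_eq]
  simp [ind, Finset.sum_ite_irrel, Model.sum_V, Model.outMarginal, Model.outLaw,
    Model.outGivenInputs]

lemma prob_state_out : prob (jointLaw W p p₁ V) (fun ω => (ω.x₁, ω.y)) (x₁, y) =
    (Model.ofPMF W p p₁ V).p₁ x₁ * (Model.ofPMF W p p₁ V).outLaw x₁ y := by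
  classical
  rw [prob_jointLaw, Model.expect_eq]
  simp [ind, ite_and, Finset.sum_ite_irrel, Model.sum_V, Model.outLaw, Model.outGivenInputs]

lemma prob_out_state : prob (jointLaw W p p₁ V) (fun ω => (ω.y, ω.x₁)) (y, x₁) =
    (Model.ofPMF W p p₁ V).p₁ x₁ * (Model.ofPMF W p p₁ V).outLaw x₁ y := by
  classical
  rw [prob_jointLaw, Model.expect_eq]
  simp [ind, ite_and, Finset.sum_ite_irrel, Model.sum_V, Model.outLaw, Model.outGivenInputs]

lemma prob_source_out_state : prob (jointLaw W p p₁ V) (fun ω => (ω.x, ω.y, ω.x₁)) (x, y, x₁) =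
    (Model.ofPMF W p p₁ V).p x * (Model.ofPMF W p p₁ V).p₁ x₁ * (Model.ofPMF W p p₁ V).outGivenInputs x x₁ y := by
  classical
  rw [prob_jointLaw, Model.expect_eq]
  simp [ind, ite_and, Finset.sum_ite_irrel, Model.sum_V, Model.outGivenInputs]
  ring

lemma prob_source_state_out : prob (jointLaw W p p₁ V) (fun ω => (ω.x, ω.x₁, ω.y)) (x, x₁, y) =
    (Model.ofPMF W p p₁ V).p x * (Model.ofPMF W p p₁ V).p₁ x₁ * (Model.ofPMF W p p₁ V).outGivenInputs x x₁ y := by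
  classical
  rw [prob_jointLaw, Model.expect_eq]
  simp [ind, ite_and, Finset.sum_ite_irrel, Model.sum_V, Model.outGivenInputs]
  ring

lemma prob_comp_state_out : prob (jointLaw W p p₁ V) (fun ω => (ω.yh, ω.x₁, ω.y)) (c, x₁, y) =
    (Model.ofPMF W p p₁ V).p₁ x₁ * (Model.ofPMF W p p₁ V).pairLaw x₁ y c := by
  classical
  rw [prob_jointLaw, Model.expect_eq]
  simp [ind, ite_and, Finset.sum_ite_irrel, Model.pairLaw, Model.pairGivenInputs]

lemma prob_source_comp_state_out :
    prob (jointLaw W p p₁ V) (fun ω => (ω.x, ω.yh, ω.x₁, ω.y)) (x, c, x₁, y) =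
      (Model.ofPMF W p p₁ V).p x * (Model.ofPMF W p p₁ V).p₁ x₁ * (Model.ofPMF W p p₁ V).pairGivenInputs x x₁ y c := by
  classical
  rw [prob_jointLaw, Model.expect_eq]
  simp [ind, ite_and, Finset.sum_ite_irrel, Model.pairGivenInputs]
  ring

lemma prob_relayOut_state_out : prob (jointLaw W p p₁ V) (fun ω => (ω.y₁, ω.x₁, ω.y)) (y₁, x₁, y) =
    (Model.ofPMF W p p₁ V).p₁ x₁ * ∑ x, (Model.ofPMF W p p₁ V).p x * (Model.ofPMF W p p₁ V).W x x₁ y y₁ := by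
  classical
  rw [prob_jointLaw, Model.expect_eq]
  simp [ind, ite_and, Finset.sum_ite_irrel, Model.sum_V]

lemma prob_relayOut_comp_state_out :
    prob (jointLaw W p p₁ V) (fun ω => (ω.y₁, ω.yh, ω.x₁, ω.y)) (y₁, c, x₁, y) =
      (Model.ofPMF W p p₁ V).p₁ x₁ * ((∑ x, (Model.ofPMF W p p₁ V).p x * (Model.ofPMF W p p₁ V).W x x₁ y y₁) * (Model.ofPMF W p p₁ V).V x₁ y₁ c) := by
  classical
  rw [prob_jointLaw, Model.expect_eq]
  simp [ind, ite_and, Finset.sum_ite_irrel, Finset.sum_mul, mul_assoc]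

end Marginals

end Entropies

/-! ### Time-sharing by erasures and the rate -/

section Rate

namespace Model

variable {A A₁ B B₁ C : Type*} [Fintype A] [Fintype A₁] [Fintype B] [Fintype B₁] [Fintype C]
variable (m : Model A A₁ B B₁ C)

/-- Gibbs' inequality: an expected log-likelihood ratio is nonnegative. -/
lemma expect_logb_div_nonneg {a b : A → A₁ → B → B₁ → C → ℝ}
    (ha : ∀ x x₁ y y₁ c, 0 < m.joint (x, x₁, y, y₁, c) → 0 < a x x₁ y y₁ c)
    (hb : ∀ x x₁ y y₁ c, 0 < m.joint (x, x₁, y, y₁, c) → 0 < b x x₁ y y₁ c)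
    (h : m.expect (fun x x₁ y y₁ c => b x x₁ y y₁ c / a x x₁ y y₁ c) ≤ 1) :
    0 ≤ m.expect fun x x₁ y y₁ c => Real.logb 2 (a x x₁ y y₁ c / b x x₁ y y₁ c) := by
  have hl2 : 0 < Real.log 2 := Real.log_pos (by norm_num)
  have h1 : (1 - m.expect (fun x x₁ y y₁ c => b x x₁ y y₁ c / a x x₁ y y₁ c)) / Real.log 2 ≤
      m.expect fun x x₁ y y₁ c => Real.logb 2 (a x x₁ y y₁ c / b x x₁ y y₁ c) := by
    rw [← m.sum_joint, expect, expect, ← Finset.sum_sub_distrib, Finset.sum_div]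
    refine Finset.sum_le_sum fun z _ => ?_
    rcases (m.joint_nonneg z).eq_or_lt with hz | hz
    · simp [← hz]
    · have hap := ha _ _ _ _ _ hz
      have hbp := hb _ _ _ _ _ hz
      generalize a z.1 z.2.1 z.2.2.1 z.2.2.2.1 z.2.2.2.2 = u at hap
      generalize b z.1 z.2.1 z.2.2.1 z.2.2.2.1 z.2.2.2.2 = v at hbp
      have h2 := Real.log_le_sub_one_of_pos (div_pos hbp hap)
      rw [← inv_div, Real.log_inv, inv_div] at h2
      calc _ = m.joint z * (1 - v / u) / Real.log 2 := by rw [mul_one_sub]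
        _ ≤ m.joint z * Real.log (u / v) / Real.log 2 :=
            div_le_div_of_nonneg_right (mul_le_mul_of_nonneg_left (by linarith) hz.le) hl2.le
        _ = _ := by rw [Real.logb, mul_div_assoc]
  exact le_trans (div_nonneg (by linarith) hl2.le) h1

/-- `I(X; Y | X₁)`. -/
def directRate : ℝ :=
  m.expect fun x x₁ y _ _ => Real.logb 2 (m.outGivenInputs x x₁ y / m.outLaw x₁ y)

/-- `I(Y₁; Ŷ₁ | X₁, Y)`. -/
def residualRate : ℝ :=
  m.expect fun _ x₁ y y₁ c => Real.logb 2 (m.V x₁ y₁ c * m.outLaw x₁ y / m.pairLaw x₁ y c)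

lemma sum_outMarginal : ∑ y, m.outMarginal y = 1 := by
  unfold outMarginal
  rw [Finset.sum_comm, ← m.sum_p₁]
  exact Finset.sum_congr rfl fun x₁ _ => by rw [← Finset.mul_sum, m.sum_outLaw, mul_one]

lemma sum_pairLaw (x₁ : A₁) (y : B) : ∑ c, m.pairLaw x₁ y c = m.outLaw x₁ y := by
  unfold pairLaw outLaw
  rw [Finset.sum_comm]
  refine Finset.sum_congr rfl fun x _ => ?_
  rw [← Finset.mul_sum]
  congr 1
  unfold pairGivenInputs outGivenInputs
  rw [Finset.sum_comm]
  exact Finset.sum_congr rfl fun y₁ _ => by rw [← Finset.mul_sum, m.sum_V, mul_one]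

lemma stateRate_nonneg : 0 ≤ m.stateRate := by
  refine m.expect_logb_div_nonneg (a := fun _ x₁ y _ _ => m.outLaw x₁ y)
    (b := fun _ _ y _ _ => m.outMarginal y)
    (fun x x₁ y y₁ c h => (m.marginals_pos h).2.1) (fun x x₁ y y₁ c h => (m.marginals_pos h).2.2.1) ?_
  rw [m.expect_state_output fun x₁ y => m.outMarginal y / m.outLaw x₁ y, ← m.sum_p₁]
  refine Finset.sum_le_sum fun x₁ _ => mul_le_of_le_one_right (m.p₁_nonneg _) ?_
  rw [← m.sum_outMarginal]
  exact Finset.sum_le_sum fun y _ =>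
    mul_div_le_of_nonneg (m.outLaw_nonneg _ _) (m.outMarginal_nonneg _)

lemma compRate_nonneg : 0 ≤ m.compRate := by
  refine m.expect_logb_div_nonneg (a := fun _ x₁ _ y₁ c => m.V x₁ y₁ c)
    (b := fun _ x₁ _ _ c => m.compLaw x₁ c)
    (fun x x₁ y y₁ c h => (m.pos_of_joint_pos h).2.2.2)
    (fun x x₁ y y₁ c h => (m.marginals_pos h).2.2.2.1) ?_
  rw [m.expect_relay fun x₁ y₁ c => m.compLaw x₁ c / m.V x₁ y₁ c, ← m.sum_p₁]
  refine Finset.sum_le_sum fun x₁ _ => mul_le_of_le_one_right (m.p₁_nonneg _) ?_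
  rw [← m.sum_relayOutLaw x₁]
  refine Finset.sum_le_sum fun y₁ _ => mul_le_of_le_one_right (m.relayOutLaw_nonneg _ _) ?_
  rw [← m.sum_compLaw x₁]
  exact Finset.sum_le_sum fun c _ =>
    mul_div_le_of_nonneg (m.V_nonneg _ _ _) (m.compLaw_nonneg _ _)

lemma residualRate_nonneg : 0 ≤ m.residualRate := by
  refine m.expect_logb_div_nonneg (a := fun _ x₁ y y₁ c => m.V x₁ y₁ c * m.outLaw x₁ y)
    (b := fun _ x₁ y _ c => m.pairLaw x₁ y c)
    (fun x x₁ y y₁ c h => mul_pos (m.pos_of_joint_pos h).2.2.2 (m.marginals_pos h).2.1)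
    (fun x x₁ y y₁ c h => (m.marginals_pos h).2.2.2.2.2) ?_
  have h1 : ∀ x₁ y y₁, ∑ c, m.V x₁ y₁ c * (m.pairLaw x₁ y c / (m.V x₁ y₁ c * m.outLaw x₁ y)) ≤
      1 := by
    intro x₁ y y₁
    refine le_trans ?_ (div_self_le_one (m.outLaw x₁ y))
    rw [← m.sum_pairLaw, Finset.sum_div]
    refine Finset.sum_le_sum fun c _ => ?_
    rw [m.sum_pairLaw, mul_comm (m.V x₁ y₁ c) (m.outLaw x₁ y), ← div_div]
    exact mul_div_le_of_nonneg (m.V_nonneg _ _ _)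
      (div_nonneg (m.pairLaw_nonneg _ _ _) (m.outLaw_nonneg _ _))
  rw [expect_eq, ← m.sum_p₁]
  refine Finset.sum_le_sum fun x₁ _ => mul_le_of_le_one_right (m.p₁_nonneg _) ?_
  rw [← m.sum_p]
  refine Finset.sum_le_sum fun x _ => mul_le_of_le_one_right (m.p_nonneg _) ?_
  rw [← m.sum_W x x₁]
  exact Finset.sum_le_sum fun y _ => Finset.sum_le_sum fun y₁ _ =>
    mul_le_of_le_one_right (m.W_nonneg _ _ _ _) (h1 x₁ y y₁)

/-- The Markov chain `Ŷ₁ → (X₁, Y₁) → (X, Y)` in terms of rates: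
`I(Y₁; Ŷ₁ | X₁, Y) = I(Y₁; Ŷ₁ | X₁) - I(Ŷ₁; X, Y | X₁) + I(X; Ŷ₁ | X₁, Y)`. -/
lemma residualRate_eq : m.residualRate = m.compRate - m.jointRate + m.messageRate := by
  unfold residualRate compRate jointRate messageRate
  rw [sub_add, ← expect_sub, ← expect_sub]
  refine m.expect_congr fun x x₁ y y₁ c h => ?_
  have hV := (m.pos_of_joint_pos h).2.2.2
  obtain ⟨hg, ho, hm, hc, hq, hl⟩ := m.marginals_pos h
  simp only at hV
  rw [logb_div_eq (mul_pos hV ho) hl, logb_div_eq hV hc, logb_div_eq hq (mul_pos ho hc),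
    logb_div_eq hq hl, Real.logb_mul hV.ne' ho.ne', Real.logb_mul ho.ne' hc.ne']
  ring

/-- The compressed relay output is kept with probability `α` and erased otherwise. -/
def erase (α : ℝ) (h0 : 0 ≤ α) (h1 : α ≤ 1) : Model A A₁ B B₁ (Option C) where
  p := m.p
  p₁ := m.p₁
  W := m.W
  V x₁ y₁ c := c.elim (1 - α) fun c => α * m.V x₁ y₁ c
  p_nonneg := m.p_nonneg
  p₁_nonneg := m.p₁_nonneg
  W_nonneg := m.W_nonneg
  V_nonneg x₁ y₁ c := by
    cases c
    · simpa using h1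
    · exact mul_nonneg h0 (m.V_nonneg _ _ _)
  sum_p := m.sum_p
  sum_p₁ := m.sum_p₁
  sum_W := m.sum_W
  sum_V x₁ y₁ := by
    simp [Fintype.sum_option, ← Finset.mul_sum, m.sum_V]

section Erase

variable {α : ℝ} (h0 : 0 ≤ α) (h1 : α ≤ 1)

lemma expect_erase (f : A → A₁ → B → B₁ → Option C → ℝ) : (m.erase α h0 h1).expect f =
    m.expect (fun x x₁ y y₁ c => α * f x x₁ y y₁ (some c)) +
      m.expect (fun x x₁ y y₁ _ => (1 - α) * f x x₁ y y₁ none) := by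
  rw [← expect_add, expect_eq, expect_eq]
  have h : ∀ x x₁ y y₁, ∑ c, (m.erase α h0 h1).V x₁ y₁ c * f x x₁ y y₁ c =
      ∑ c, m.V x₁ y₁ c * (α * f x x₁ y y₁ (some c) + (1 - α) * f x x₁ y y₁ none) := by
    intro x x₁ y y₁
    simp only [mul_add, Finset.sum_add_distrib, ← Finset.sum_mul, m.sum_V, one_mul,
      Fintype.sum_option]
    rw [add_comm]
    congr 1
    exact Finset.sum_congr rfl fun c _ => by simp only [erase, Option.elim]; ring
  simp only [h]
  rfl

lemma erase_outLaw (x₁ y) : (m.erase α h0 h1).outLaw x₁ y = m.outLaw x₁ y := rfl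

lemma erase_compLaw_some (x₁ c) : (m.erase α h0 h1).compLaw x₁ (some c) = α * m.compLaw x₁ c := by
  unfold compLaw
  rw [Finset.mul_sum]
  exact Finset.sum_congr rfl fun y₁ _ => mul_left_comm _ _ _

lemma erase_compLaw_none (x₁) : (m.erase α h0 h1).compLaw x₁ none = 1 - α := by
  have h : ∀ y₁, (m.erase α h0 h1).V x₁ y₁ none = 1 - α := fun _ => rfl
  unfold compLaw
  simp only [h]
  rw [← Finset.sum_mul, sum_relayOutLaw, one_mul]

lemma erase_pairGivenInputs_some (x x₁ y c) : (m.erase α h0 h1).pairGivenInputs x x₁ y (some c) =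
    α * m.pairGivenInputs x x₁ y c := by
  unfold pairGivenInputs
  rw [Finset.mul_sum]
  exact Finset.sum_congr rfl fun y₁ _ => mul_left_comm _ _ _

lemma erase_pairGivenInputs_none (x x₁ y) : (m.erase α h0 h1).pairGivenInputs x x₁ y none =
    (1 - α) * m.outGivenInputs x x₁ y := by
  unfold pairGivenInputs outGivenInputs
  rw [Finset.mul_sum]
  exact Finset.sum_congr rfl fun y₁ _ => mul_comm _ _

lemma erase_pairLaw_some (x₁ y c) : (m.erase α h0 h1).pairLaw x₁ y (some c) =
    α * m.pairLaw x₁ y c := by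
  unfold pairLaw
  rw [Finset.mul_sum]
  refine Finset.sum_congr rfl fun x _ => ?_
  rw [erase_pairGivenInputs_some]
  exact mul_left_comm _ _ _

lemma erase_pairLaw_none (x₁ y) : (m.erase α h0 h1).pairLaw x₁ y none =
    (1 - α) * m.outLaw x₁ y := by
  unfold pairLaw outLaw
  rw [Finset.mul_sum]
  refine Finset.sum_congr rfl fun x _ => ?_
  rw [erase_pairGivenInputs_none]
  exact mul_left_comm _ _ _

lemma erase_stateRate : (m.erase α h0 h1).stateRate = m.stateRate := by
  unfold stateRate
  rw [expect_erase, ← expect_add]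
  refine m.expect_congr fun x x₁ y y₁ c _ => ?_
  rw [← add_mul, add_sub_cancel, one_mul]
  rfl

lemma erase_compRate : (m.erase α h0 h1).compRate = α * m.compRate := by
  unfold compRate
  rw [expect_erase, ← expect_add, ← expect_const_mul]
  refine m.expect_congr fun x x₁ y y₁ c _ => ?_
  rw [erase_compLaw_some, erase_compLaw_none]
  simp only [erase, Option.elim]
  rw [mul_logb_mul_div_mul]
  have := mul_logb_mul_div_mul (1 - α) 1 1
  simp only [mul_one, div_one, Real.logb_one, mul_zero] at this
  rw [this, add_zero]

lemma erase_messageRate : (m.erase α h0 h1).messageRate =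
    α * m.messageRate + (1 - α) * m.directRate := by
  unfold messageRate directRate
  rw [expect_erase, ← expect_const_mul, ← expect_const_mul]
  simp only [erase_pairGivenInputs_some, erase_pairGivenInputs_none, erase_pairLaw_some,
    erase_pairLaw_none, mul_logb_mul_div_mul]

lemma erase_jointRate : (m.erase α h0 h1).jointRate =
    α * m.jointRate + (1 - α) * m.directRate := by
  unfold jointRate directRate
  rw [expect_erase, ← expect_const_mul, ← expect_const_mul]
  simp only [erase_pairGivenInputs_some, erase_pairGivenInputs_none, erase_compLaw_some,
    erase_compLaw_none, erase_outLaw, mul_left_comm _ α, mul_comm (m.outLaw _ _) (1 - α),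
    mul_logb_mul_div_mul]

end Erase

end Model

variable {X X₁ Y Y₁ Yh : Type*} [Fintype X] [Fintype X₁] [Fintype Y] [Fintype Y₁] [Fintype Yh]
variable (W : X → X₁ → PMF (Y × Y₁)) (p : PMF X) (p₁ : PMF X₁) (V : X₁ → Y₁ → PMF Yh)

lemma condMutualInfo_source_out :
    condMutualInfo (jointLaw W p p₁ V) Outcome.x Outcome.y Outcome.x₁ =
      (Model.ofPMF W p p₁ V).directRate := by
  rw [condMutualInfo_jointLaw]
  refine Model.expect_congr _ fun x x₁ y y₁ c h => ?_
  obtain ⟨hp, hp1, -, -⟩ := Model.pos_of_joint_pos _ h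
  simp only at hp hp1
  simp only [prob_source_out_state, prob_out_state, prob_source_state, prob_state]
  obtain ⟨hg, ho, -⟩ := Model.marginals_pos _ h
  rw [logb_div_eq (by positivity) (by positivity),
    logb_div_eq (by positivity) (by positivity), logb_div_eq hg ho,
    Real.logb_mul (by positivity) hg.ne', Real.logb_mul hp1.ne' ho.ne']
  ring

lemma mutualInfo_state_out : mutualInfo (jointLaw W p p₁ V) Outcome.x₁ Outcome.y =
    (Model.ofPMF W p p₁ V).stateRate := by
  unfold mutualInfo Model.stateRate
  rw [entropy_jointLaw, condEntropy_jointLaw, neg_sub_neg, ← Model.expect_sub]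
  refine Model.expect_congr _ fun x x₁ y y₁ c h => ?_
  obtain ⟨hp, hp1, -, -⟩ := Model.pos_of_joint_pos _ h
  simp only at hp hp1
  simp only [prob_out, prob_state_out, prob_state]
  obtain ⟨hg, ho, hm, -⟩ := Model.marginals_pos _ h
  rw [logb_div_eq (by positivity) hm, logb_div_eq ho hm,
    Real.logb_mul hp1.ne' ho.ne']
  ring

lemma condMutualInfo_relayOut_comp :
    condMutualInfo (jointLaw W p p₁ V) Outcome.y₁ Outcome.yh (fun ω => (ω.x₁, ω.y)) =
      (Model.ofPMF W p p₁ V).residualRate := by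
  rw [condMutualInfo_jointLaw]
  refine Model.expect_congr _ fun x x₁ y y₁ c h => ?_
  obtain ⟨hp, hp1, hW, hV⟩ := Model.pos_of_joint_pos _ h
  simp only at hp hp1 hW hV
  simp only [prob_relayOut_comp_state_out, prob_comp_state_out, prob_relayOut_state_out,
    prob_state_out]
  obtain ⟨hg, ho, hm, hc, hq, hl⟩ := Model.marginals_pos _ h
  have hr : 0 < ∑ x, (Model.ofPMF W p p₁ V).p x * (Model.ofPMF W p p₁ V).W x x₁ y y₁ :=
    sum_pos_of_term (fun x => mul_nonneg (Model.p_nonneg _ _) (Model.W_nonneg _ _ _ _ _))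
      (mul_pos hp hW)
  rw [mul_div_mul_left _ _ hp1.ne', mul_div_mul_left _ _ hp1.ne',
    logb_div_eq (mul_pos hr hV) hl, logb_div_eq hr ho,
    logb_div_eq (mul_pos hV ho) hl, Real.logb_mul hr.ne' hV.ne', Real.logb_mul hV.ne' ho.ne']
  ring

lemma condMutualInfo_source_comp :
    condMutualInfo (jointLaw W p p₁ V) Outcome.x Outcome.yh (fun ω => (ω.x₁, ω.y)) =
      (Model.ofPMF W p p₁ V).messageRate - (Model.ofPMF W p p₁ V).directRate := by
  unfold Model.messageRate Model.directRate
  rw [condMutualInfo_jointLaw, ← Model.expect_sub]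
  refine Model.expect_congr _ fun x x₁ y y₁ c h => ?_
  obtain ⟨hp, hp1, -, -⟩ := Model.pos_of_joint_pos _ h
  simp only at hp hp1
  simp only [prob_source_comp_state_out, prob_comp_state_out, prob_source_state_out,
    prob_state_out]
  obtain ⟨hg, ho, hm, hc, hq, hl⟩ := Model.marginals_pos _ h
  rw [logb_div_eq (by positivity) (by positivity),
    logb_div_eq (by positivity) (by positivity), logb_div_eq hg ho,
    logb_div_eq hq hl, Real.logb_mul (by positivity) hg.ne', Real.logb_mul hp1.ne' ho.ne',
    Real.logb_mul (by positivity) hq.ne', Real.logb_mul hp1.ne' hl.ne']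
  ring

/-- Time sharing: with the erasure probability chosen so that the compressed relay output just fits
through the link from the relay, both conditions for good block codes hold below the rate. -/
theorem achievable_of_lt_tafRate {R : ℝ} (hR : R < tafRate (jointLaw W p p₁ V)) :
    Achievable W R := by
  have : Nonempty X := ⟨p.support_nonempty.some⟩
  have : Nonempty X₁ := ⟨p₁.support_nonempty.some⟩
  rcases le_total R 0 with hR0 | hR0
  · exact achievable_of_nonpos hR0
  set m := Model.ofPMF W p p₁ V
  unfold tafRate at hR
  rw [condMutualInfo_source_out, mutualInfo_state_out, condMutualInfo_relayOut_comp,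
    condMutualInfo_source_comp] at hR
  have hs := m.stateRate_nonneg
  have hd := m.residualRate_nonneg
  set α := clip (m.stateRate / m.residualRate) with hα
  have h0 : 0 ≤ α := le_min (div_nonneg hs hd) zero_le_one
  have h1 : α ≤ 1 := min_le_right _ _
  have hαd : α * m.residualRate ≤ m.stateRate := by
    rcases hd.eq_or_lt with h | h
    · rw [← h, mul_zero]; exact hs
    · exact (le_div_iff₀ h).mp (min_le_left _ _)
  refine achievable_of_lt (m.erase α h0 h1) (fun _ _ _ _ => rfl) hR0 ?_ ?_ ?_
  · exact Model.compRate_nonneg _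
  · rw [Model.erase_messageRate]
    linarith
  · rw [Model.erase_compRate, Model.erase_jointRate, Model.erase_stateRate]
    rw [m.residualRate_eq] at hαd
    linarith

end Rate

end RelayChannel

end

theorem mainTheorem6 {X X₁ Y Y₁ Yh : Type*}
    [Fintype X] [Fintype X₁] [Fintype Y] [Fintype Y₁] [Fintype Yh]
    (W : X → X₁ → PMF (Y × Y₁))
    (p : PMF X) (p₁ : PMF X₁) (V : X₁ → Y₁ → PMF Yh) :
    (∀ R : ℝ, R < RelayChannel.tafRate (RelayChannel.jointLaw W p p₁ V) →
      RelayChannel.Achievable W R) ∧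
    (∀ R : ℝ, R ≤ RelayChannel.tafRate (RelayChannel.jointLaw W p p₁ V) →
      R ∈ closure {R' : ℝ | RelayChannel.Achievable W R'}) := by
  refine ⟨fun R hR => RelayChannel.achievable_of_lt_tafRate W p p₁ V hR, fun R hR => ?_⟩
  refine closure_mono (s := Set.Iio R) (fun R' hR' =>
    RelayChannel.achievable_of_lt_tafRate W p p₁ V (lt_of_lt_of_le hR' hR)) ?_
  rw [closure_Iio]
  exact Set.mem_Iic.mpr le_rfl
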